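/- **Blaschke–Petkantschin formula in Miles's form, for $\beta=1,2,4$.** Let $\mathbb F_\beta=\mathbb R,\mathbb C,\mathbb H$ (real quaternions) for $\beta=1,2,4$ respectively, and let $0\le N\le n$ be integers. Let $\mathcal M_{n\times N}^\beta$ be the space of $n\times N$ matrices over $\mathbb F_\beta$, and let $(\mathrm dM)$ be Lebesgue measure in the $\beta nN$ real components of the entries of $M$. Let $G_{N,n}^\beta$ be the Grassmannian of $N$-dimensional subspaces of $\mathbb F_\beta^n$ (with scalars acting on the right), and let $\mathrm d\omega_{N,n}^\beta$ be the measure on it that is invariant under the unitary group of $\mathbb F_\beta^n$ and has total mass $$\prod_{i=1}^N\frac{\sigma_{\beta(n-i+1)}}{\sigma_{\beta(N-i+1)}},\qquad \sigma_l=\frac{2\pi^{l/2}}{\Gamma(l/2)} .$$ For $M\in\mathcal M^\beta_{N\times N}$ with singular values $\sigma_1(M),\dots,\sigma_N(M)$ put $\det M^\dagger M=\prod_{l=1}^N\sigma_l(M)^2$ (so that for $\beta=4$ it is the square root of the determinant of the $2N\times 2N$ complex matrix representing $M^\dagger M$). For each $V\in G_{N,n}^\beta$ let $A_V$ be an $n\times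 N$ matrix whose columns are an orthonormal basis of $V$ (any choice is allowed). Then for every integrable $g:\mathcal M_{n\times N}^\beta\to\mathbb R$, the function $M\mapsto g(A_VM)\,(\det M^\dagger M)^{\beta(n-N)/2}$ is integrable on $\mathcal M_{N\times N}^\beta$ for almost every $V$, its integral is an integrable function of $V$, and $$\int_{\mathcal M_{n\times N}^\beta} g(M)\,(\mathrm dM)=\int_{V\in G_{N,n}^\beta}\mathrm d\omega_{N,n}^\beta\int_{\mathcal M_{N\times N}^\beta}(\mathrm dM)\;g(A_VM)\,\bigl(\det M^\dagger M\bigr)^{\beta(n-N)/2}.$$ -/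

import Mathlib

open MeasureTheory Matrix
open scoped Quaternion

noncomputable section

/-! ### The scalars `𝔽 = ℝ, ℂ, ℍ` -/

instance Quaternion.instMeasurableSpaceBorel : MeasurableSpace ℍ[ℝ] := borel _

instance Quaternion.instBorelSpaceBorel : BorelSpace ℍ[ℝ] := ⟨rfl⟩

/-- The scalar systems considered here, namely `ℝ`, `ℂ` and the real quaternions (these are
the only three instances given): `star x * x = ‖x‖²`, together with the determinant of
Hermitian matrices, which for the quaternions needs a convention. -/
class HermitianScalar (𝔽 : Type) [NormedDivisionRing 𝔽] [StarRing 𝔽] [NormedAlgebra ℝ 𝔽] where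
  star_mul_self_eq : ∀ x : 𝔽, star x * x = algebraMap ℝ 𝔽 (‖x‖ ^ 2)
  /-- The determinant of a Hermitian matrix, as a real number. -/
  hdet : ∀ {N : ℕ}, Matrix (Fin N) (Fin N) 𝔽 → ℝ

instance Real.instHermitianScalar : HermitianScalar ℝ where
  star_mul_self_eq x := by simp [sq]
  hdet W := W.det

instance Complex.instHermitianScalar : HermitianScalar ℂ where
  star_mul_self_eq x := by
    have h := Complex.conj_mul' x
    simpa using h
  hdet W := W.det.re

/-- The `2 × 2` complex block `[[z, w], [-conj w, conj z]]` of the quaternion `q = z + w j`. -/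
def Quaternion.block (q : ℍ[ℝ]) : Matrix (Fin 2) (Fin 2) ℂ :=
  !![⟨q.re, q.imI⟩, ⟨q.imJ, q.imK⟩; ⟨-q.imJ, q.imK⟩, ⟨q.re, -q.imI⟩]

/-- The `2n × 2N` complex matrix that represents an `n × N` quaternion matrix blockwise. -/
def Quaternion.complexMatrix {n N : ℕ} (M : Matrix (Fin n) (Fin N) ℍ[ℝ]) :
    Matrix (Fin n × Fin 2) (Fin N × Fin 2) ℂ :=
  Matrix.of fun a b => Quaternion.block (M a.1 b.1) a.2 b.2

/-- In the quaternion case the `2N` eigenvalues of the complex representation of a Hermitian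
matrix `W = M† M` are `σ₁², σ₁², …, σ_N², σ_N²`; its determinant is by definition
`σ₁² ⋯ σ_N²`, which is the square root of the determinant of the complex representation. -/
instance Quaternion.instHermitianScalar : HermitianScalar ℍ[ℝ] where
  star_mul_self_eq x := by
    rw [Quaternion.star_mul_self, Quaternion.normSq_eq_norm_mul_self, sq]
    rfl
  hdet W := Real.sqrt (Quaternion.complexMatrix W).det.re

/-! ### Matrices with their Lebesgue measure -/

instance Matrix.instMeasurableSpacePi {m k : Type} {𝔽 : Type} [MeasurableSpace 𝔽] :
    MeasurableSpace (Matrix m k 𝔽) :=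
  inferInstanceAs (MeasurableSpace (m → k → 𝔽))

instance Matrix.instBorelSpacePi {m k : Type} [Countable m] [Countable k] {𝔽 : Type}
    [TopologicalSpace 𝔽] [SecondCountableTopology 𝔽] [MeasurableSpace 𝔽] [BorelSpace 𝔽] :
    BorelSpace (Matrix m k 𝔽) :=
  inferInstanceAs (BorelSpace (m → k → 𝔽))

/-- `(dM)`: the product of the Lebesgue measures of the entries, hence of their real
components. -/
instance Matrix.instMeasureSpacePi {m k : Type} [Fintype m] [Fintype k] {𝔽 : Type}
    [MeasureSpace 𝔽] : MeasureSpace (Matrix m k 𝔽) where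
  volume := (volume : Measure (m → k → 𝔽))

/-! ### Stiefel manifold, Grassmannian, and their invariant measures -/

section Geometry

set_option linter.unusedSectionVars false

variable (𝔽 : Type) [NormedDivisionRing 𝔽] [StarRing 𝔽] [NormedAlgebra ℝ 𝔽]

/-- `β = 1, 2, 4`, the number of real components of a scalar. -/
def beta : ℕ := Module.finrank ℝ 𝔽

/-- The Stiefel manifold of `n × N` matrices with orthonormal columns. -/
def Stiefel (n N : ℕ) : Type := {A : Matrix (Fin n) (Fin N) 𝔽 // Aᴴ * A = 1}

instance Stiefel.instMeasurableSpace [MeasurableSpace 𝔽] (n N : ℕ) :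
    MeasurableSpace (Stiefel 𝔽 n N) :=
  inferInstanceAs (MeasurableSpace {A : Matrix (Fin n) (Fin N) 𝔽 // Aᴴ * A = 1})

/-- The Grassmannian of `N`-dimensional subspaces of `𝔽ⁿ`. Scalars act on the right (this only
matters for the quaternions), so that `{A c : c ∈ 𝔽ᴺ}` is a subspace for each matrix `A`. -/
def Grassmannian (n N : ℕ) : Type :=
  {V : Submodule 𝔽ᵐᵒᵖ (Fin n → 𝔽) // Module.finrank 𝔽ᵐᵒᵖ V = N}

variable {𝔽}

/-- The span of the columns of a matrix, with scalars acting on the right. -/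
def columnSpan {n N : ℕ} (A : Matrix (Fin n) (Fin N) 𝔽) : Submodule 𝔽ᵐᵒᵖ (Fin n → 𝔽) :=
  Submodule.span 𝔽ᵐᵒᵖ (Set.range A.col)

theorem sum_op_smul_col {n N : ℕ} (A : Matrix (Fin n) (Fin N) 𝔽) (c : Fin N → 𝔽ᵐᵒᵖ) :
    ∑ j, c j • A.col j = A *ᵥ fun j => (c j).unop := by
  ext i
  simp [Matrix.mulVec, dotProduct]

theorem finrank_columnSpan {n N : ℕ} {A : Matrix (Fin n) (Fin N) 𝔽} (hA : Aᴴ * A = 1) :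
    Module.finrank 𝔽ᵐᵒᵖ (columnSpan A) = N := by
  have hli : LinearIndependent 𝔽ᵐᵒᵖ A.col := by
    rw [Fintype.linearIndependent_iff]
    intro c hc j
    rw [sum_op_smul_col] at hc
    have h := congrArg (fun v => Aᴴ *ᵥ v) hc
    simp only [Matrix.mulVec_mulVec, hA, Matrix.one_mulVec, Matrix.mulVec_zero] at h
    exact MulOpposite.unop_injective (congrFun h j)
  exact (finrank_span_eq_card hli).trans (Fintype.card_fin N)

/-- The point of the Grassmannian spanned by an orthonormal `N`-frame. -/
def Stiefel.span {n N : ℕ} (A : Stiefel 𝔽 n N) : Grassmannian 𝔽 n N :=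
  ⟨columnSpan A.1, finrank_columnSpan A.2⟩

/-- The Grassmannian is the quotient of the Stiefel manifold by the right action of the unitary
`N × N` matrices, and it carries the quotient of the Borel structure. -/
instance Grassmannian.instMeasurableSpace [MeasurableSpace 𝔽] (n N : ℕ) :
    MeasurableSpace (Grassmannian 𝔽 n N) :=
  MeasurableSpace.map Stiefel.span inferInstance

/-- The columns of `A` are an orthonormal basis of `V`. -/
def IsOrthonormalFrame {n N : ℕ} (A : Matrix (Fin n) (Fin N) 𝔽) (V : Grassmannian 𝔽 n N) :
    Prop :=
  Aᴴ * A = 1 ∧ columnSpan A = V.1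

theorem smul_mem_columnSpan {n N : ℕ} (A : Matrix (Fin n) (Fin N) 𝔽) (c : Fin N → 𝔽) :
    A *ᵥ c ∈ columnSpan A := by
  have h := sum_op_smul_col A fun j => MulOpposite.op (c j)
  simp only [MulOpposite.unop_op] at h
  rw [← h]
  exact Submodule.sum_mem _ fun j _ =>
    Submodule.smul_mem _ _ (Submodule.subset_span ⟨j, rfl⟩)

variable [HermitianScalar 𝔽]

theorem star_dotProduct_self {ι : Type} [Fintype ι] (v : ι → 𝔽) :
    star v ⬝ᵥ v = algebraMap ℝ 𝔽 (∑ i, ‖v i‖ ^ 2) := by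
  simp [dotProduct, HermitianScalar.star_mul_self_eq, map_sum]

/-- Every subspace has an orthonormal frame (Gram–Schmidt). -/
theorem Grassmannian.exists_frame {n N : ℕ} (V : Grassmannian 𝔽 n N) :
    ∃ A : Matrix (Fin n) (Fin N) 𝔽, IsOrthonormalFrame A V := by
  have key : ∀ k ≤ N, ∃ A : Matrix (Fin n) (Fin k) 𝔽, Aᴴ * A = 1 ∧ columnSpan A ≤ V.1 := by
    intro k
    induction k with
    | zero =>
      intro _
      refine ⟨0, Subsingleton.elim _ _, ?_⟩
      rw [columnSpan, Submodule.span_le]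
      rintro _ ⟨j, rfl⟩
      exact j.elim0
    | succ k ih =>
      intro hk
      obtain ⟨A, hA, hAV⟩ := ih (by omega)
      have hlt : columnSpan A < V.1 := by
        refine lt_of_le_of_ne hAV fun he => ?_
        have h1 := finrank_columnSpan hA
        have h2 := V.2
        rw [he] at h1
        omega
      obtain ⟨v, hvV, hvA⟩ := SetLike.exists_of_lt hlt
      set w : Fin n → 𝔽 := v - A *ᵥ (Aᴴ *ᵥ v) with hw
      have hwV : w ∈ V.1 := Submodule.sub_mem _ hvV (hAV (smul_mem_columnSpan A _))
      have hw0 : w ≠ 0 := by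
        intro h0
        rw [hw, sub_eq_zero] at h0
        exact hvA (h0 ▸ smul_mem_columnSpan A _)
      have hAw : Aᴴ *ᵥ w = 0 := by
        rw [hw, Matrix.mulVec_sub, Matrix.mulVec_mulVec, hA, Matrix.one_mulVec, sub_self]
      set s : ℝ := ∑ i, ‖w i‖ ^ 2 with hs
      have hspos : 0 < s := by
        obtain ⟨i, hi⟩ := Function.ne_iff.1 hw0
        refine Finset.sum_pos' (fun _ _ => by positivity) ⟨i, Finset.mem_univ _, ?_⟩
        have : 0 < ‖w i‖ := norm_pos_iff.2 hi
        positivity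
      set r : 𝔽 := algebraMap ℝ 𝔽 (Real.sqrt s)⁻¹ with hr
      set x : Fin n → 𝔽 := MulOpposite.op r • w with hx
      have hxi : ∀ i, x i = (Real.sqrt s)⁻¹ • w i := by
        intro i
        simp only [hx, hr, Pi.smul_apply, MulOpposite.smul_eq_mul_unop, MulOpposite.unop_op]
        rw [Algebra.smul_def, Algebra.commutes]
      have hxV : x ∈ V.1 := Submodule.smul_mem _ _ hwV
      have hxx : star x ⬝ᵥ x = 1 := by
        rw [star_dotProduct_self]
        have : ∑ i, ‖x i‖ ^ 2 = 1 := by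
          simp only [hxi, norm_smul, mul_pow, ← Finset.mul_sum, ← hs]
          rw [Real.norm_of_nonneg (by positivity), inv_pow, Real.sq_sqrt hspos.le,
            inv_mul_cancel₀ hspos.ne']
        rw [this, map_one]
      have hAx : Aᴴ *ᵥ x = 0 := by
        have : Aᴴ *ᵥ x = MulOpposite.op r • (Aᴴ *ᵥ w) := by
          rw [hx, Matrix.mulVec_smul]
        rw [this, hAw, smul_zero]
      have hAx' : ∀ i, ∑ j, star (A j i) * x j = 0 := fun i => congrFun hAx i
      have hxA' : ∀ i, ∑ j, star (x j) * A j i = 0 := by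
        intro i
        have h := congrArg star (hAx' i)
        simpa [star_sum] using h
      refine ⟨Matrix.of fun i j => Fin.snoc (α := fun _ => 𝔽) (A i) (x i) j, ?_, ?_⟩
      · ext a b
        refine Fin.lastCases ?_ (fun a => ?_) a <;> refine Fin.lastCases ?_ (fun b => ?_) b
        · simpa [Matrix.mul_apply, dotProduct] using hxx
        · simpa [Matrix.mul_apply, Matrix.one_apply, Fin.ext_iff, b.2.ne'] using hxA' b
        · simpa [Matrix.mul_apply, Matrix.one_apply, Fin.ext_iff, a.2.ne] using hAx' a
        · simpa [Matrix.mul_apply, Matrix.one_apply, Fin.ext_iff] using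
            congrFun (congrFun hA a) b
      · rw [columnSpan, Submodule.span_le]
        rintro _ ⟨j, rfl⟩
        refine Fin.lastCases ?_ (fun j => ?_) j
        · refine (congrArg (fun y => y ∈ V.1) ?_).mpr hxV
          ext i
          simp [Matrix.col]
        · have : A.col j ∈ V.1 := hAV (Submodule.subset_span ⟨j, rfl⟩)
          refine (congrArg (fun y => y ∈ V.1) ?_).mpr this
          ext i
          simp [Matrix.col]
  have : Module.Finite 𝔽ᵐᵒᵖ 𝔽 := ⟨⟨{1}, by
    rw [Finset.coe_singleton, Submodule.eq_top_iff']
    exact fun x => Submodule.mem_span_singleton.2 ⟨MulOpposite.op x, by simp⟩⟩⟩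
  obtain ⟨A, hA, hAV⟩ := key N le_rfl
  exact ⟨A, hA, Submodule.eq_of_le_of_finrank_eq hAV (by rw [finrank_columnSpan hA, V.2])⟩

/-- The first `N` columns of a unitary `n × n` matrix. -/
def firstColumns {n N : ℕ} (h : N ≤ n) (u : unitary (Matrix (Fin n) (Fin n) 𝔽)) :
    Stiefel 𝔽 n N :=
  ⟨u.1.submatrix id (Fin.castLE h), by
    have hu : (u.1)ᴴ * u.1 = 1 := (Unitary.mem_iff.1 u.2).1
    ext i j
    have hij := congrFun (congrFun hu (Fin.castLE h i)) (Fin.castLE h j)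
    simpa [Matrix.mul_apply, Matrix.one_apply, Fin.ext_iff] using hij⟩

variable [FiniteDimensional ℝ 𝔽] [ContinuousStar 𝔽]

instance compactSpace_unitary {n : ℕ} :
    CompactSpace (unitary (Matrix (Fin n) (Fin n) 𝔽)) := by
  have : ProperSpace 𝔽 := FiniteDimensional.proper_real 𝔽
  refine isCompact_iff_compactSpace.1 ?_
  have hK : IsCompact {u : Matrix (Fin n) (Fin n) 𝔽 | ∀ i, u i ∈ Set.pi Set.univ
      fun _ : Fin n => Metric.closedBall (0 : 𝔽) 1} :=
    isCompact_pi_infinite fun _ => isCompact_univ_pi fun _ => isCompact_closedBall 0 1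
  refine hK.of_isClosed_subset isClosed_unitary ?_
  intro u hu i j _
  have h1 : (star u * u) j j = 1 := by rw [(Unitary.mem_iff.1 hu).1, Matrix.one_apply_eq]
  have h2 : star (u.col j) ⬝ᵥ u.col j = 1 := by
    simpa [Matrix.mul_apply, dotProduct, Matrix.star_eq_conjTranspose] using h1
  rw [star_dotProduct_self, ← map_one (algebraMap ℝ 𝔽)] at h2
  have h3 := (algebraMap ℝ 𝔽).injective h2
  have h4 : ‖u i j‖ ^ 2 ≤ 1 := by
    rw [← h3]
    exact Finset.single_le_sum (f := fun i => ‖u.col j i‖ ^ 2) (fun _ _ => by positivity)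
      (Finset.mem_univ i)
  simpa using (sq_le_one_iff₀ (norm_nonneg _)).1 h4

variable (𝔽) [MeasureSpace 𝔽] [BorelSpace 𝔽]

/-- The surface area `2 π^(l/2) / Γ(l/2)` of the unit sphere of `ℝˡ`. -/
def sphereArea (l : ℕ) : ℝ := 2 * Real.pi ^ ((l : ℝ) / 2) / Real.Gamma ((l : ℝ) / 2)

/-- The volume of the Stiefel manifold, `∏_{i = 1}^{N} σ_{β (n - i + 1)}`, for `N ≤ n`. -/
def stiefelVolume (n N : ℕ) : ℝ := ∏ i ∈ Finset.range N, sphereArea (beta 𝔽 * (n - i))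

instance unitary.instMeasurableSpace {n : ℕ} :
    MeasurableSpace (unitary (Matrix (Fin n) (Fin n) 𝔽)) :=
  Subtype.instMeasurableSpace

instance unitary.instBorelSpace {n : ℕ} : BorelSpace (unitary (Matrix (Fin n) (Fin n) 𝔽)) := by
  have : ProperSpace 𝔽 := FiniteDimensional.proper_real 𝔽
  exact Subtype.borelSpace _

/-- The Haar probability measure of the group of unitary `n × n` matrices. -/
def unitaryHaar (n : ℕ) : Measure (unitary (Matrix (Fin n) (Fin n) 𝔽)) :=
  Measure.haarMeasure ⊤

variable {n N : ℕ} (h : N ≤ n)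

/-- The invariant measure `(U† dU)` on the Stiefel manifold: the invariant measure
of total mass `stiefelVolume`. -/
def stiefelMeasure : Measure (Stiefel 𝔽 n N) :=
  ENNReal.ofReal (stiefelVolume 𝔽 n N) • (unitaryHaar 𝔽 n).map (firstColumns h)

/-- The invariant measure `dω` on the Grassmannian: it is the image of the invariant measure on
the Stiefel manifold, divided by the volume of the fibres (which are copies of the group of
unitary `N × N` matrices). Its total mass is
`∏_{i = 1}^{N} σ_{β (n - i + 1)} / σ_{β (N - i + 1)}`. -/
def grassmannMeasure : Measure (Grassmannian 𝔽 n N) :=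
  (ENNReal.ofReal (stiefelVolume 𝔽 N N))⁻¹ • (stiefelMeasure 𝔽 h).map Stiefel.span

/-! ### The formula -/

/-- The function of `M` in the inner integral, `g (A M) det (M† M) ^ (β (n - N) / 2)`. -/
def petkantschinIntegrand {n N : ℕ} (g : Matrix (Fin n) (Fin N) 𝔽 → ℝ)
    (A : Matrix (Fin n) (Fin N) 𝔽) (M : Matrix (Fin N) (Fin N) 𝔽) : ℝ :=
  g (A * M) * HermitianScalar.hdet (Mᴴ * M) ^ ((beta 𝔽 : ℝ) * ((n : ℝ) - N) / 2)

/-- The Blaschke–Petkantschin formula in Miles's form over `𝔽`, for every integrable `g` and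
every choice of a reference orthonormal frame `A V` of each subspace `V`; the integrals on the
right exist. -/
def BlaschkePetkantschinMiles {n N : ℕ} (h : N ≤ n) : Prop :=
  ∀ g : Matrix (Fin n) (Fin N) 𝔽 → ℝ, Integrable g →
    ∀ A : Grassmannian 𝔽 n N → Matrix (Fin n) (Fin N) 𝔽, (∀ V, IsOrthonormalFrame (A V) V) →
      (∀ᵐ V ∂(grassmannMeasure 𝔽 h), Integrable (petkantschinIntegrand 𝔽 g (A V))) ∧
      Integrable (fun V => ∫ M, petkantschinIntegrand 𝔽 g (A V) M) (grassmannMeasure 𝔽 h) ∧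
      ∫ M, g M = ∫ V, (∫ M, petkantschinIntegrand 𝔽 g (A V) M) ∂(grassmannMeasure 𝔽 h)

end Geometry

end

/-!
The formula is an instance of the uniqueness of invariant measures on a homogeneous space. Every
`n × N` matrix is `U [T; 0]` with `U` unitary and `T` square (`exists_eq_unitary_mul`), and almost
every one has an invertible `T` (`ae_rectModulus_ne_zero`), so that up to a null set the product of
the unitary group and of the group of invertible `N × N` matrices acts transitively by
`M ↦ U M T`. Lebesgue measure transforms under this action by a power of the modulus `|T|`, the
factor by which `T` scales volumes in `𝔽ᴺ`, and so does the measure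
`g ↦ ∫ ∫ g (U [T; 0]) |T| ^ (n - N) dT dU`, in which `U` runs through the unitary group with its
Haar probability measure. Here `|T| = det (T† T) ^ (β / 2)`, which is the only point at which `ℝ`,
`ℂ` and `ℍ` are treated separately (the class `MilesScalar`).

Uniqueness is proved by the usual exchange of integrals. The function
`M ↦ ∫ ∫ g (U M T) |T| ^ (n - N) dT dU` is constant on matrices of full rank up to a power of the
modulus (`orbitIntegral_eq`). Integrating it against `f` and substituting `M ↦ U⁻¹ M T⁻¹` gives
`∫ g` times a number that depends on `f` only (`lintegral_mul_orbitIntegral`,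
`dualOrbitIntegral_eq`). With `f` fixed, the two measures are therefore proportional
(`orbitIntegral_stdFrame`).

The constant comes from the Gaussian density `exp (-π tr M† M)`, whose Lebesgue integral is one. Its
integral over the orbit is the moment of order `n - N` of the modulus of an `N × N` Gaussian matrix.
Rotating the first row `x` to `(|x|, 0, …, 0)` reduces it to size `N - 1`
(`lintegral_momentDensity_succ`), and each step contributes a radial Gaussian moment, which polar
coordinates evaluate as a quotient of sphere areas (`lintegral_norm_pow_gaussian_vector`).

The inner integral over `T` depends on the frame `U [1; 0]` only through its column span, since
`dT` and `|T|` are invariant under unitary matrices on the left; by the definition of the measurable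
structure of the Grassmannian it is then measurable there
(`measurable_lintegral_frameMeasure`). The formula for nonnegative functions
(`lintegral_eq_lintegral_frameMeasure`) yields the one for integrable functions: null sets of
matrices are null for almost every subspace, which allows a measurable representative of `g`, and
the positive and negative parts are treated separately (`integral_eq_integral_frameMeasure`).
-/

noncomputable section

/-! ### The real modulus of a square matrix -/

section Modulus

variable {𝔽 : Type} [NormedDivisionRing 𝔽] [NormedAlgebra ℝ 𝔽]

/-- Left multiplication of column vectors by a matrix over `𝔽`, as a real linear map. -/
def mulVecReal {m n : ℕ} (T : Matrix (Fin m) (Fin n) 𝔽) : (Fin n → 𝔽) →ₗ[ℝ] (Fin m → 𝔽) where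
  toFun v := T *ᵥ v
  map_add' := T.mulVec_add
  map_smul' r v := T.mulVec_smul r v

/-- Right multiplication of row vectors by a matrix over `𝔽`, as a real linear map. -/
def vecMulReal {m n : ℕ} (T : Matrix (Fin m) (Fin n) 𝔽) : (Fin m → 𝔽) →ₗ[ℝ] (Fin n → 𝔽) where
  toFun v := v ᵥ* T
  map_add' := T.add_vecMul
  map_smul' r v := by simp [Matrix.smul_vecMul]

@[simp] theorem mulVecReal_apply {m n : ℕ} (T : Matrix (Fin m) (Fin n) 𝔽) (v : Fin n → 𝔽) :
    mulVecReal T v = T *ᵥ v := rfl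

@[simp] theorem vecMulReal_apply {m n : ℕ} (T : Matrix (Fin m) (Fin n) 𝔽) (v : Fin m → 𝔽) :
    vecMulReal T v = v ᵥ* T := rfl

/-- The factor by which left multiplication by `T` scales volumes in `𝔽ᴺ`. -/
def modulus {N : ℕ} (T : Matrix (Fin N) (Fin N) 𝔽) : ℝ := |LinearMap.det (mulVecReal T)|

theorem modulus_nonneg {N : ℕ} (T : Matrix (Fin N) (Fin N) 𝔽) : 0 ≤ modulus T := abs_nonneg _

theorem modulus_mul {N : ℕ} (S T : Matrix (Fin N) (Fin N) 𝔽) :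
    modulus (S * T) = modulus S * modulus T := by
  have : mulVecReal (S * T) = mulVecReal S ∘ₗ mulVecReal T := by
    refine LinearMap.ext fun v => ?_
    simp
  rw [modulus, this, LinearMap.det_comp, abs_mul, modulus, modulus]

@[simp] theorem modulus_one {N : ℕ} : modulus (1 : Matrix (Fin N) (Fin N) 𝔽) = 1 := by
  have : mulVecReal (1 : Matrix (Fin N) (Fin N) 𝔽) = LinearMap.id := by
    refine LinearMap.ext fun v => ?_
    simp
  rw [modulus, this, LinearMap.det_id, abs_one]

theorem isUnit_of_modulus_ne_zero [FiniteDimensional ℝ 𝔽] {N : ℕ}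
    {T : Matrix (Fin N) (Fin N) 𝔽} (hT : modulus T ≠ 0) : IsUnit T := by
  have h1 : IsUnit (LinearMap.det (mulVecReal T)) := by
    rw [modulus, abs_ne_zero] at hT
    exact hT.isUnit
  let e := LinearMap.equivOfDetNeZero (mulVecReal T) h1.ne_zero
  have he : ∀ v, e v = T *ᵥ v := fun v => rfl
  have hS : ∃ S : Matrix (Fin N) (Fin N) 𝔽, T * S = 1 := by
    refine ⟨Matrix.of fun i j => e.symm (Pi.single j 1) i, ?_⟩
    ext i j
    have := congrFun (e.apply_symm_apply (Pi.single j 1)) i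
    rw [he] at this
    rw [Matrix.mul_apply]
    simpa [Matrix.mulVec, dotProduct, Matrix.one_apply, Pi.single_apply] using this
  obtain ⟨S, hS⟩ := hS
  -- a right inverse of the injective `T` is also a left inverse
  have hS' : S * T = 1 := by
    ext i j
    have h2 : (S * T) *ᵥ Pi.single j 1 = Pi.single j 1 := by
      apply e.injective
      rw [he, he, Matrix.mulVec_mulVec, ← Matrix.mul_assoc, hS, Matrix.one_mul]
    have := congrFun h2 i
    simpa [Matrix.mulVec_single_one, Matrix.one_apply, Pi.single_apply] using this
  exact ⟨⟨T, S, hS, hS'⟩, rfl⟩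

theorem modulus_ne_zero_of_isUnit {N : ℕ}
    {T : Matrix (Fin N) (Fin N) 𝔽} (hT : IsUnit T) : modulus T ≠ 0 := by
  obtain ⟨u, rfl⟩ := hT
  have h := modulus_mul (u : Matrix (Fin N) (Fin N) 𝔽) (↑u⁻¹)
  rw [Units.mul_inv, modulus_one] at h
  exact left_ne_zero_of_mul (h ▸ one_ne_zero)

/-- The determinant of a block triangular endomorphism of a product. -/
theorem LinearMap.det_of_fst_comp_inr_eq_zero {V W : Type*} [AddCommGroup V] [Module ℝ V]
    [AddCommGroup W] [Module ℝ W] [FiniteDimensional ℝ V] [FiniteDimensional ℝ W]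
    (f : (V × W) →ₗ[ℝ] (V × W)) (hf : ∀ w, (f (0, w)).1 = 0) :
    LinearMap.det f = LinearMap.det (LinearMap.fst ℝ V W ∘ₗ f ∘ₗ LinearMap.inl ℝ V W) *
      LinearMap.det (LinearMap.snd ℝ V W ∘ₗ f ∘ₗ LinearMap.inr ℝ V W) := by
  let b := Module.finBasis ℝ V
  let c := Module.finBasis ℝ W
  have : LinearMap.toMatrix (b.prod c) (b.prod c) f = Matrix.fromBlocks
      (LinearMap.toMatrix b b (LinearMap.fst ℝ V W ∘ₗ f ∘ₗ LinearMap.inl ℝ V W)) 0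
      (LinearMap.toMatrix b c (LinearMap.snd ℝ V W ∘ₗ f ∘ₗ LinearMap.inl ℝ V W))
      (LinearMap.toMatrix c c (LinearMap.snd ℝ V W ∘ₗ f ∘ₗ LinearMap.inr ℝ V W)) := by
    ext (_ | _) (_ | _) <;> simp [LinearMap.toMatrix_apply, hf]
  rw [← LinearMap.det_toMatrix (b.prod c), this, Matrix.det_fromBlocks_zero₁₂,
    LinearMap.det_toMatrix, LinearMap.det_toMatrix]

variable [FiniteDimensional ℝ 𝔽]

/-- Multiplication by a scalar `t` maps the unit ball onto the ball of radius `‖t‖`, which fixes its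
determinant. -/
theorem abs_det_mulLeft (t : 𝔽) : |LinearMap.det (LinearMap.mulLeft ℝ t)| = ‖t‖ ^ beta 𝔽 := by
  let _ : MeasurableSpace 𝔽 := borel 𝔽
  have : BorelSpace 𝔽 := ⟨rfl⟩
  have : ProperSpace 𝔽 := FiniteDimensional.proper_real 𝔽
  let μ : Measure 𝔽 := Measure.addHaar
  -- both sides are the factor by which `t` scales the volume of the unit ball
  have h1 := Measure.addHaar_image_linearMap μ (LinearMap.mulLeft ℝ t) (Metric.closedBall 0 1)
  have h2 : LinearMap.mulLeft ℝ t '' Metric.closedBall 0 1 = Metric.closedBall 0 ‖t‖ := by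
    rcases eq_or_ne t 0 with rfl | ht
    · ext x
      simp [(Set.nonempty_of_mem (Metric.mem_closedBall_self (x := (0 : 𝔽)) zero_le_one))]
    · have ht' : 0 < ‖t‖ := norm_pos_iff.2 ht
      ext x
      simp only [Set.mem_image, Metric.mem_closedBall, dist_zero_right, LinearMap.mulLeft_apply]
      constructor
      · rintro ⟨y, hy, rfl⟩
        rw [norm_mul]
        exact mul_le_of_le_one_right ht'.le hy
      · intro hx
        refine ⟨t⁻¹ * x, ?_, by rw [mul_inv_cancel_left₀ ht]⟩
        rw [norm_mul, norm_inv]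
        exact inv_mul_le_one_of_le₀ hx ht'.le
  have h3 := Measure.addHaar_closedBall' μ (0 : 𝔽) (norm_nonneg t)
  rw [h2, h3] at h1
  have h4 : μ (Metric.closedBall 0 1) ≠ 0 := (Metric.measure_closedBall_pos μ _ one_pos).ne'
  have h5 : μ (Metric.closedBall 0 1) ≠ ⊤ := measure_closedBall_lt_top.ne
  rw [ENNReal.mul_left_inj h4 h5] at h1
  exact ((ENNReal.ofReal_eq_ofReal_iff (by positivity) (abs_nonneg _)).1 h1).symm

/-- The `(N + 1) × (N + 1)` matrix with first row `(t, 0, …, 0)` and with the rows `(y i, B i)`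
below it. -/
def lowerBlock {N : ℕ} (t : 𝔽) (y : Fin N → 𝔽) (B : Matrix (Fin N) (Fin N) 𝔽) :
    Matrix (Fin (N + 1)) (Fin (N + 1)) 𝔽 :=
  Matrix.of (Fin.cons (Pi.single 0 t) fun i => Fin.cons (y i) (B i))

theorem modulus_lowerBlock {N : ℕ} (t : 𝔽) (y : Fin N → 𝔽) (B : Matrix (Fin N) (Fin N) 𝔽) :
    modulus (lowerBlock t y B) = ‖t‖ ^ beta 𝔽 * modulus B := by
  let e : (𝔽 × (Fin N → 𝔽)) ≃ₗ[ℝ] (Fin (N + 1) → 𝔽) := Fin.consLinearEquiv ℝ (fun _ => 𝔽)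
  rw [modulus, ← LinearMap.det_conj _ e.symm, LinearMap.det_of_fst_comp_inr_eq_zero, abs_mul,
    ← abs_det_mulLeft, modulus]
  · congr 3
    · ext1 x
      simp [e, lowerBlock, Matrix.mulVec, Fin.consLinearEquiv, dotProduct, Fin.sum_univ_succ]
    · ext1 x
      ext i
      simp [e, lowerBlock, Matrix.mulVec, Fin.consLinearEquiv, dotProduct, Fin.sum_univ_succ, Fin.tail]
  · intro w
    simp [e, lowerBlock, Matrix.mulVec, Fin.consLinearEquiv, dotProduct, Fin.sum_univ_succ]

theorem det_vecMul_rows {N k : ℕ} (T : Matrix (Fin N) (Fin N) 𝔽)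
    (f : (Fin k → Fin N → 𝔽) →ₗ[ℝ] (Fin k → Fin N → 𝔽)) (hf : ∀ M i, f M i = M i ᵥ* T) :
    LinearMap.det f = LinearMap.det (vecMulReal T) ^ k := by
  have : f = LinearMap.pi fun i => vecMulReal T ∘ₗ LinearMap.proj i := by
    refine LinearMap.ext fun M => funext fun i => ?_
    simp [hf]
  rw [this, LinearMap.det_pi, Finset.prod_const, Finset.card_univ, Fintype.card_fin]

theorem det_mulVec_cols {N k : ℕ} (T : Matrix (Fin N) (Fin N) 𝔽)
    (f : (Fin N → Fin k → 𝔽) →ₗ[ℝ] (Fin N → Fin k → 𝔽))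
    (hf : ∀ M j, (fun i => f M i j) = T *ᵥ fun i => M i j) :
    LinearMap.det f = LinearMap.det (mulVecReal T) ^ k := by
  let e : (Fin N → Fin k → 𝔽) ≃ₗ[ℝ] (Fin k → Fin N → 𝔽) :=
    { toFun := fun M j i => M i j
      invFun := fun M j i => M i j
      map_add' := fun _ _ => rfl
      map_smul' := fun _ _ => rfl }
  have : e.toLinearMap ∘ₗ f ∘ₗ e.symm.toLinearMap =
      LinearMap.pi fun i => mulVecReal T ∘ₗ LinearMap.proj i := by
    refine LinearMap.ext fun M => funext fun i => ?_
    exact hf (e.symm M) i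
  rw [← LinearMap.det_conj f e, this, LinearMap.det_pi, Finset.prod_const, Finset.card_univ,
    Fintype.card_fin]

end Modulus

/-! ### Orthonormal frames and the factorization `M = U [T; 0]` -/

section Frames

set_option linter.unusedSectionVars false

variable {𝔽 : Type} [NormedDivisionRing 𝔽]

instance moduleFinite_mulOpposite : Module.Finite 𝔽ᵐᵒᵖ 𝔽 := ⟨⟨{1}, by
  rw [Finset.coe_singleton, Submodule.eq_top_iff']
  exact fun x => Submodule.mem_span_singleton.2 ⟨MulOpposite.op x, by simp⟩⟩⟩

variable [StarRing 𝔽] [NormedAlgebra ℝ 𝔽]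

theorem mem_columnSpan_iff {n N : ℕ} {A : Matrix (Fin n) (Fin N) 𝔽} {v : Fin n → 𝔽} :
    v ∈ columnSpan A ↔ ∃ c, v = A *ᵥ c := by
  constructor
  · intro h
    obtain ⟨c, rfl⟩ := (Submodule.mem_span_range_iff_exists_fun _).1 h
    exact ⟨_, sum_op_smul_col A c⟩
  · rintro ⟨c, rfl⟩
    exact smul_mem_columnSpan A c

/-- A matrix whose columns lie in the span of an orthonormal frame `A` factors through `A`. -/
theorem mul_conjTranspose_mul_of_col_mem {n N k : ℕ} {A : Matrix (Fin n) (Fin N) 𝔽}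
    (hA : Aᴴ * A = 1) {M : Matrix (Fin n) (Fin k) 𝔽} (hM : ∀ j, M.col j ∈ columnSpan A) :
    A * (Aᴴ * M) = M := by
  refine Matrix.ext_col fun j => ?_
  obtain ⟨c, hc⟩ := mem_columnSpan_iff.1 (hM j)
  have h1 : (A * (Aᴴ * M)).col j = A *ᵥ (Aᴴ *ᵥ M.col j) := by
    ext i
    simp [Matrix.mul_apply, Matrix.mulVec, dotProduct]
  rw [h1, hc, Matrix.mulVec_mulVec c, hA, Matrix.one_mulVec]

/-- Two orthonormal frames of the same subspace differ by a unitary matrix on the right. -/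
theorem exists_unitary_of_columnSpan_eq {n N : ℕ} {A B : Matrix (Fin n) (Fin N) 𝔽}
    (hA : Aᴴ * A = 1) (hB : Bᴴ * B = 1) (h : columnSpan A = columnSpan B) :
    ∃ W : Matrix (Fin N) (Fin N) 𝔽, Wᴴ * W = 1 ∧ B = A * W := by
  have h1 : A * (Aᴴ * B) = B := mul_conjTranspose_mul_of_col_mem hA fun j => by
    rw [h]
    exact Submodule.subset_span ⟨j, rfl⟩
  refine ⟨Aᴴ * B, ?_, h1.symm⟩
  rw [Matrix.conjTranspose_mul, Matrix.conjTranspose_conjTranspose, Matrix.mul_assoc, h1, hB]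

theorem finrank_pi_mulOpposite (n : ℕ) : Module.finrank 𝔽ᵐᵒᵖ (Fin n → 𝔽) = n := by
  have h1 : columnSpan (1 : Matrix (Fin n) (Fin n) 𝔽) = ⊤ :=
    eq_top_iff.2 fun v _ => mem_columnSpan_iff.2 ⟨v, (Matrix.one_mulVec v).symm⟩
  have h2 := finrank_columnSpan (A := (1 : Matrix (Fin n) (Fin n) 𝔽)) (by simp)
  rwa [h1, finrank_top] at h2

/-- A subspace of dimension at most `N ≤ n` is contained in one of dimension `N`. -/
theorem exists_le_finrank_eq {n N : ℕ} (h : N ≤ n) (W : Submodule 𝔽ᵐᵒᵖ (Fin n → 𝔽))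
    (hW : Module.finrank 𝔽ᵐᵒᵖ W ≤ N) : ∃ V : Grassmannian 𝔽 n N, W ≤ V.1 := by
  obtain ⟨Q, hQ⟩ := Submodule.exists_isCompl W
  have hsum : Module.finrank 𝔽ᵐᵒᵖ W + Module.finrank 𝔽ᵐᵒᵖ Q = n := by
    rw [Submodule.finrank_add_eq_of_isCompl hQ, finrank_pi_mulOpposite]
  obtain ⟨f, hf⟩ := exists_linearIndependent_of_le_finrank (R := 𝔽ᵐᵒᵖ) (M := Q)
    (n := N - Module.finrank 𝔽ᵐᵒᵖ W) (by omega)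
  have hf' : LinearIndependent 𝔽ᵐᵒᵖ fun i => (f i : Fin n → 𝔽) :=
    hf.map' Q.subtype Q.ker_subtype
  let S := Submodule.span 𝔽ᵐᵒᵖ (Set.range fun i => (f i : Fin n → 𝔽))
  have hS : Module.finrank 𝔽ᵐᵒᵖ S = N - Module.finrank 𝔽ᵐᵒᵖ W :=
    (finrank_span_eq_card hf').trans (Fintype.card_fin _)
  have hSQ : S ≤ Q := by
    rw [Submodule.span_le]
    rintro _ ⟨i, rfl⟩
    exact (f i).2
  have hinf : W ⊓ S = ⊥ := (hQ.disjoint.mono_right hSQ).eq_bot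
  have hsup := Submodule.finrank_sup_add_finrank_inf_eq W S
  rw [hinf, finrank_bot, hS] at hsup
  exact ⟨⟨W ⊔ S, by omega⟩, le_sup_left⟩

variable [HermitianScalar 𝔽]

variable (𝔽) in
/-- The first `N` columns of the identity matrix. -/
def stdFrame {n N : ℕ} (h : N ≤ n) : Matrix (Fin n) (Fin N) 𝔽 :=
  (1 : Matrix (Fin n) (Fin n) 𝔽).submatrix id (Fin.castLE h)

theorem firstColumns_eq_mul {n N : ℕ} (h : N ≤ n) (u : unitary (Matrix (Fin n) (Fin n) 𝔽)) :
    (firstColumns h u).1 = u.1 * stdFrame 𝔽 h := by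
  ext i j
  simp [firstColumns, stdFrame, Matrix.mul_apply, Matrix.one_apply]

theorem conjTranspose_mul_stdFrame {n N : ℕ} (h : N ≤ n) :
    (stdFrame 𝔽 h)ᴴ * stdFrame 𝔽 h = 1 :=
  (firstColumns h (1 : unitary (Matrix (Fin n) (Fin n) 𝔽))).2

/-- Every orthonormal frame can be completed to a unitary matrix. -/
theorem exists_firstColumns_eq {n N : ℕ} (h : N ≤ n) (A : Stiefel 𝔽 n N) :
    ∃ u : unitary (Matrix (Fin n) (Fin n) 𝔽), firstColumns h u = A := by
  obtain ⟨k, rfl⟩ := Nat.exists_eq_add_of_le h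
  -- the missing columns are a frame of the orthogonal complement, the kernel of `A†`
  let f : (Fin (N + k) → 𝔽) →ₗ[𝔽ᵐᵒᵖ] (Fin N → 𝔽) :=
    { toFun := fun v => A.1ᴴ *ᵥ v
      map_add' := Matrix.mulVec_add _
      map_smul' := fun c v => Matrix.mulVec_smul _ c v }
  have hf : Function.Surjective f := fun v => ⟨A.1 *ᵥ v, by
    change A.1ᴴ *ᵥ (A.1 *ᵥ v) = v
    rw [Matrix.mulVec_mulVec, A.2, Matrix.one_mulVec]⟩
  have hk : Module.finrank 𝔽ᵐᵒᵖ (LinearMap.ker f) = k := by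
    have h1 := f.finrank_range_add_finrank_ker
    rw [LinearMap.range_eq_top.2 hf, finrank_top, finrank_pi_mulOpposite,
      finrank_pi_mulOpposite] at h1
    omega
  obtain ⟨B, hB, hBk⟩ := Grassmannian.exists_frame (⟨LinearMap.ker f, hk⟩ :
    Grassmannian 𝔽 (N + k) k)
  have hAB : A.1ᴴ * B = 0 := by
    refine Matrix.ext_col fun j => ?_
    have h1 : B.col j ∈ LinearMap.ker f := by
      have h0 : B.col j ∈ columnSpan B := Submodule.subset_span ⟨j, rfl⟩
      rwa [hBk] at h0
    have h2 : A.1ᴴ *ᵥ B.col j = 0 := LinearMap.mem_ker.1 h1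
    ext i
    simpa [Matrix.mul_apply, Matrix.mulVec, dotProduct] using congrFun h2 i
  have hBA : Bᴴ * A.1 = 0 := by
    rw [← Matrix.conjTranspose_conjTranspose A.1, ← Matrix.conjTranspose_mul, hAB,
      Matrix.conjTranspose_zero]
  let U : Matrix (Fin (N + k)) (Fin (N + k)) 𝔽 := Matrix.of fun i j => Fin.append (A.1 i) (B i) j
  have hU : star U * U = 1 := by
    rw [Matrix.star_eq_conjTranspose]
    ext a b
    have hAA := A.2
    refine Fin.addCases (fun a => ?_) (fun a => ?_) a <;>
      refine Fin.addCases (fun b => ?_) (fun b => ?_) b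
    · simpa [U, Matrix.mul_apply, Matrix.one_apply, Fin.ext_iff] using congrFun (congrFun hAA a) b
    · have := a.2
      simpa [U, Matrix.mul_apply, Matrix.one_apply, Fin.ext_iff,
        show (a : ℕ) ≠ N + b by omega] using congrFun (congrFun hAB a) b
    · have := b.2
      simpa [U, Matrix.mul_apply, Matrix.one_apply, Fin.ext_iff,
        show N + (a : ℕ) ≠ b by omega] using congrFun (congrFun hBA a) b
    · simpa [U, Matrix.mul_apply, Matrix.one_apply, Fin.ext_iff] using congrFun (congrFun hB a) b
  refine ⟨⟨U, Unitary.mem_iff.2 ⟨hU, mul_eq_one_comm.1 hU⟩⟩, Subtype.ext ?_⟩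
  ext i j
  have : Fin.castLE h j = Fin.castAdd k j := rfl
  simp [firstColumns, U, this]

/-- Every `n × N` matrix with `N ≤ n` is `U [T; 0]` with `U` unitary and `T` square. -/
theorem exists_eq_unitary_mul {n N : ℕ} (h : N ≤ n) (M : Matrix (Fin n) (Fin N) 𝔽) :
    ∃ (u : unitary (Matrix (Fin n) (Fin n) 𝔽)) (T : Matrix (Fin N) (Fin N) 𝔽),
      M = u.1 * stdFrame 𝔽 h * T := by
  -- the columns may be dependent, so the frame is taken in a larger subspace of dimension `N`
  obtain ⟨V, hV⟩ := exists_le_finrank_eq h (columnSpan M)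
    ((finrank_range_le_card M.col).trans_eq (Fintype.card_fin N))
  obtain ⟨A, hA, hAV⟩ := V.exists_frame
  obtain ⟨u, hu⟩ := exists_firstColumns_eq h ⟨A, hA⟩
  refine ⟨u, Aᴴ * M, ?_⟩
  rw [← firstColumns_eq_mul, hu]
  refine (mul_conjTranspose_mul_of_col_mem hA fun j => ?_).symm
  rw [hAV]
  exact hV (Submodule.subset_span ⟨j, rfl⟩)

/-! ### The Frobenius norm -/

/-- The squared Frobenius norm `tr M† M`. -/
def frobSq {n N : ℕ} (M : Matrix (Fin n) (Fin N) 𝔽) : ℝ := ∑ j, ∑ i, ‖M i j‖ ^ 2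

/-- The norms of the columns of `M` are the diagonal entries of `M† M`. -/
theorem sum_norm_sq_eq_of_conjTranspose_mul_eq {m n N : ℕ} {M : Matrix (Fin n) (Fin N) 𝔽}
    {M' : Matrix (Fin m) (Fin N) 𝔽} (h : Mᴴ * M = M'ᴴ * M') (j : Fin N) :
    ∑ i, ‖M i j‖ ^ 2 = ∑ i, ‖M' i j‖ ^ 2 := by
  have h1 := star_dotProduct_self (M.col j)
  have h2 := star_dotProduct_self (M'.col j)
  have h3 : star (M.col j) ⬝ᵥ M.col j = star (M'.col j) ⬝ᵥ M'.col j := by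
    simpa [Matrix.mul_apply, dotProduct] using congrFun (congrFun h j) j
  rw [h1, h2] at h3
  exact (algebraMap ℝ 𝔽).injective h3

theorem conjTranspose_mul_self_of_isometry {m n N : ℕ} {A : Matrix (Fin n) (Fin m) 𝔽}
    (hA : Aᴴ * A = 1) (M : Matrix (Fin m) (Fin N) 𝔽) : (A * M)ᴴ * (A * M) = Mᴴ * M := by
  rw [Matrix.conjTranspose_mul, Matrix.mul_assoc, ← Matrix.mul_assoc Aᴴ, hA, Matrix.one_mul]

theorem frobSq_isometry_mul {m n N : ℕ} {A : Matrix (Fin n) (Fin m) 𝔽}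
    (hA : Aᴴ * A = 1) (M : Matrix (Fin m) (Fin N) 𝔽) : frobSq (A * M) = frobSq M :=
  Finset.sum_congr rfl fun j _ =>
    sum_norm_sq_eq_of_conjTranspose_mul_eq (conjTranspose_mul_self_of_isometry hA M) j

theorem norm_star_eq (x : 𝔽) : ‖star x‖ = ‖x‖ := by
  rcases eq_or_ne x 0 with rfl | hx
  · simp
  · have h := congrArg norm (HermitianScalar.star_mul_self_eq x)
    rw [norm_mul, norm_algebraMap', Real.norm_of_nonneg (by positivity), sq] at h
    exact mul_right_cancel₀ (norm_ne_zero_iff.2 hx) h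

theorem frobSq_conjTranspose {n N : ℕ} (M : Matrix (Fin n) (Fin N) 𝔽) :
    frobSq Mᴴ = frobSq M := by
  simp only [frobSq, Matrix.conjTranspose_apply, norm_star_eq]
  exact Finset.sum_comm

theorem frobSq_mul_unitary {n N : ℕ} (M : Matrix (Fin n) (Fin N) 𝔽)
    {U : Matrix (Fin N) (Fin N) 𝔽} (hU : U * Uᴴ = 1) : frobSq (M * U) = frobSq M := by
  rw [← frobSq_conjTranspose, Matrix.conjTranspose_mul, frobSq_isometry_mul (by simpa using hU),
    frobSq_conjTranspose]

end Frames

/-! ### Change of variables for matrices -/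

/-- What the three scalar systems have in common beyond `HermitianScalar`: the determinant of
`M† M` is a power of the modulus of `M`, which is the same for `M` and `M†`, and the volume is
normalized by `∫ exp (-π ‖x‖²) dx = 1`. -/
class MilesScalar (𝔽 : Type) [NormedDivisionRing 𝔽] [StarRing 𝔽] [NormedAlgebra ℝ 𝔽]
    [HermitianScalar 𝔽] [MeasureSpace 𝔽] : Prop where
  hdet_nonneg : ∀ {N : ℕ} (M : Matrix (Fin N) (Fin N) 𝔽), 0 ≤ HermitianScalar.hdet (Mᴴ * M)
  hdet_rpow : ∀ {N : ℕ} (M : Matrix (Fin N) (Fin N) 𝔽),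
    HermitianScalar.hdet (Mᴴ * M) ^ ((beta 𝔽 : ℝ) / 2) = modulus M
  modulus_conjTranspose : ∀ {N : ℕ} (M : Matrix (Fin N) (Fin N) 𝔽), modulus Mᴴ = modulus M
  lintegral_gaussian : ∫⁻ x : 𝔽, ENNReal.ofReal (Real.exp (-Real.pi * ‖x‖ ^ 2)) = 1

section ChangeOfVariables

set_option linter.unusedSectionVars false

variable {𝔽 : Type} [NormedDivisionRing 𝔽] [StarRing 𝔽] [NormedAlgebra ℝ 𝔽] [HermitianScalar 𝔽]
  [MeasureSpace 𝔽] [MilesScalar 𝔽]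

/-- The modulus of a rectangular matrix, the square root of the modulus of `M† M`. -/
def rectModulus {n N : ℕ} (M : Matrix (Fin n) (Fin N) 𝔽) : ℝ := Real.sqrt (modulus (Mᴴ * M))

theorem rectModulus_isometry_mul {m n N : ℕ} {A : Matrix (Fin n) (Fin m) 𝔽}
    (hA : Aᴴ * A = 1) (M : Matrix (Fin m) (Fin N) 𝔽) :
    rectModulus (A * M) = rectModulus M := by
  rw [rectModulus, conjTranspose_mul_self_of_isometry hA, rectModulus]

theorem rectModulus_eq_modulus {N : ℕ} (M : Matrix (Fin N) (Fin N) 𝔽) :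
    rectModulus M = modulus M := by
  rw [rectModulus, modulus_mul, MilesScalar.modulus_conjTranspose,
    Real.sqrt_mul_self (modulus_nonneg M)]

theorem modulus_unitary {N : ℕ} {U : Matrix (Fin N) (Fin N) 𝔽} (hU : Uᴴ * U = 1) :
    modulus U = 1 := by
  rw [← rectModulus_eq_modulus, rectModulus, hU, modulus_one, Real.sqrt_one]

theorem modulus_unitary_mul {N : ℕ} {U : Matrix (Fin N) (Fin N) 𝔽} (hU : Uᴴ * U = 1)
    (M : Matrix (Fin N) (Fin N) 𝔽) : modulus (U * M) = modulus M := by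
  rw [modulus_mul, modulus_unitary hU, one_mul]

/-- Right multiplication of rows scales volumes as left multiplication of columns does, because
conjugation turns one into the other with `T†` in place of `T`. -/
theorem abs_det_vecMulReal [StarModule ℝ 𝔽] {N : ℕ} (T : Matrix (Fin N) (Fin N) 𝔽) :
    |LinearMap.det (vecMulReal T)| = modulus T := by
  let e : (Fin N → 𝔽) ≃ₗ[ℝ] (Fin N → 𝔽) := starLinearEquiv ℝ (A := Fin N → 𝔽)
  have : e.toLinearMap ∘ₗ vecMulReal T ∘ₗ e.symm.toLinearMap = mulVecReal Tᴴ := by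
    refine LinearMap.ext fun v => ?_
    have : ∀ w, e w = star w := fun w => rfl
    have h2 : e.symm v = star v := by rw [LinearEquiv.symm_apply_eq, this, star_star]
    simp only [LinearMap.comp_apply, LinearEquiv.coe_coe, this, h2, vecMulReal_apply,
      mulVecReal_apply]
    rw [Matrix.star_vecMul, star_star]
  rw [← LinearMap.det_conj _ e, this, ← modulus, MilesScalar.modulus_conjTranspose]

variable [FiniteDimensional ℝ 𝔽] [BorelSpace 𝔽] [(volume : Measure 𝔽).IsAddHaarMeasure]
  [SecondCountableTopology 𝔽] [ContinuousStar 𝔽]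

instance Matrix.isAddHaarMeasure_volume {m k : ℕ} :
    (volume : Measure (Fin m → Fin k → 𝔽)).IsAddHaarMeasure := by
  have : (volume : Measure (Fin k → 𝔽)).IsAddHaarMeasure :=
    Measure.pi.isAddHaarMeasure fun _ => volume
  exact Measure.pi.isAddHaarMeasure fun _ => volume

instance Matrix.sigmaFinite_volume {m k : ℕ} :
    SigmaFinite (volume : Measure (Matrix (Fin m) (Fin k) 𝔽)) :=
  inferInstanceAs (SigmaFinite (volume : Measure (Fin m → Fin k → 𝔽)))

theorem continuous_modulus {N : ℕ} :
    Continuous (modulus : Matrix (Fin N) (Fin N) 𝔽 → ℝ) := by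
  let b := Module.finBasis ℝ (Fin N → 𝔽)
  have h : (modulus : Matrix (Fin N) (Fin N) 𝔽 → ℝ) =
      fun T => |(LinearMap.toMatrix b b (mulVecReal T)).det| := by
    ext1 T
    rw [modulus, LinearMap.det_toMatrix]
  rw [h]
  refine (Continuous.matrix_det (continuous_matrix fun i j => ?_)).abs
  simp only [LinearMap.toMatrix_apply, mulVecReal_apply]
  exact (LinearMap.continuous_of_finiteDimensional (b.coord i)).comp
    (continuous_id.matrix_mulVec continuous_const)

theorem measurable_modulus {N : ℕ} :
    Measurable (modulus : Matrix (Fin N) (Fin N) 𝔽 → ℝ) := continuous_modulus.measurable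

theorem measurable_rectModulus {n N : ℕ} :
    Measurable (rectModulus : Matrix (Fin n) (Fin N) 𝔽 → ℝ) :=
  (Real.continuous_sqrt.comp (continuous_modulus.comp
    (continuous_id.matrix_conjTranspose.matrix_mul continuous_id))).measurable

theorem continuous_frobSq {n N : ℕ} :
    Continuous (frobSq : Matrix (Fin n) (Fin N) 𝔽 → ℝ) := by
  unfold frobSq
  fun_prop

theorem measurable_frobSq {n N : ℕ} :
    Measurable (frobSq : Matrix (Fin n) (Fin N) 𝔽 → ℝ) := continuous_frobSq.measurable

/-- The change of variables formula for a linear map in terms of the lower integral. -/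
theorem lintegral_comp_linearMap {E : Type*} [NormedAddCommGroup E] [NormedSpace ℝ E]
    [MeasurableSpace E] [BorelSpace E] [FiniteDimensional ℝ E] (μ : Measure E)
    [μ.IsAddHaarMeasure] (f : E →ₗ[ℝ] E) (hf : LinearMap.det f ≠ 0) {F : E → ENNReal}
    (hF : Measurable F) :
    ENNReal.ofReal |LinearMap.det f| * ∫⁻ x, F (f x) ∂μ = ∫⁻ x, F x ∂μ := by
  have h1 := Measure.map_linearMap_addHaar_eq_smul_addHaar μ hf
  have hfm : Measurable f := (LinearMap.continuous_of_finiteDimensional f).measurable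
  rw [← lintegral_map hF hfm, h1, lintegral_smul_measure, smul_eq_mul, ← mul_assoc,
    ← ENNReal.ofReal_mul (abs_nonneg _), abs_inv, mul_inv_cancel₀ (abs_ne_zero.2 hf),
    ENNReal.ofReal_one, one_mul]

theorem lintegral_mul_left {N k : ℕ} {T : Matrix (Fin N) (Fin N) 𝔽} (hT : modulus T ≠ 0)
    {F : Matrix (Fin N) (Fin k) 𝔽 → ENNReal} (hF : Measurable F) :
    ENNReal.ofReal (modulus T ^ k) * ∫⁻ M : Matrix (Fin N) (Fin k) 𝔽, F (T * M) =
      ∫⁻ M : Matrix (Fin N) (Fin k) 𝔽, F M := by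
  let f : (Fin N → Fin k → 𝔽) →ₗ[ℝ] (Fin N → Fin k → 𝔽) :=
    { toFun := fun M => T * (show Matrix (Fin N) (Fin k) 𝔽 from M)
      map_add' := fun M M' => Matrix.mul_add _ _ _
      map_smul' := fun c M => Matrix.mul_smul _ _ _ }
  have hdet : LinearMap.det f = LinearMap.det (mulVecReal T) ^ k :=
    det_mulVec_cols T f fun M j => rfl
  have h0 : LinearMap.det f ≠ 0 := by
    rw [hdet]
    exact pow_ne_zero _ (abs_ne_zero.1 hT)
  have h := lintegral_comp_linearMap (volume : Measure (Fin N → Fin k → 𝔽)) f h0 (F := F) hF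
  rwa [hdet, abs_pow] at h

theorem lintegral_mul_right [StarModule ℝ 𝔽] {N k : ℕ} {T : Matrix (Fin N) (Fin N) 𝔽}
    (hT : modulus T ≠ 0) {F : Matrix (Fin k) (Fin N) 𝔽 → ENNReal} (hF : Measurable F) :
    ENNReal.ofReal (modulus T ^ k) * ∫⁻ M : Matrix (Fin k) (Fin N) 𝔽, F (M * T) =
      ∫⁻ M : Matrix (Fin k) (Fin N) 𝔽, F M := by
  let f : (Fin k → Fin N → 𝔽) →ₗ[ℝ] (Fin k → Fin N → 𝔽) :=
    { toFun := fun M => (show Matrix (Fin k) (Fin N) 𝔽 from M) * T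
      map_add' := fun M M' => Matrix.add_mul _ _ _
      map_smul' := fun c M => Matrix.smul_mul _ _ _ }
  have hdet : LinearMap.det f = LinearMap.det (vecMulReal T) ^ k :=
    det_vecMul_rows T f fun M j => rfl
  have h1 := abs_det_vecMulReal T
  have h0 : LinearMap.det f ≠ 0 := by
    rw [hdet]
    exact pow_ne_zero _ (abs_ne_zero.1 (h1 ▸ hT))
  have h := lintegral_comp_linearMap (volume : Measure (Fin k → Fin N → 𝔽)) f h0 (F := F) hF
  rwa [hdet, abs_pow, h1] at h

theorem lintegral_unitary_mul {N k : ℕ} {U : Matrix (Fin N) (Fin N) 𝔽} (hU : Uᴴ * U = 1)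
    {F : Matrix (Fin N) (Fin k) 𝔽 → ENNReal} (hF : Measurable F) :
    ∫⁻ M : Matrix (Fin N) (Fin k) 𝔽, F (U * M) = ∫⁻ M : Matrix (Fin N) (Fin k) 𝔽, F M := by
  have h := lintegral_mul_left (k := k) (by rw [modulus_unitary hU]; exact one_ne_zero) hF
  rwa [modulus_unitary hU, one_pow, ENNReal.ofReal_one, one_mul] at h

theorem lintegral_mul_unitary [StarModule ℝ 𝔽] {N k : ℕ} {U : Matrix (Fin N) (Fin N) 𝔽}
    (hU : Uᴴ * U = 1) {F : Matrix (Fin k) (Fin N) 𝔽 → ENNReal} (hF : Measurable F) :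
    ∫⁻ M : Matrix (Fin k) (Fin N) 𝔽, F (M * U) = ∫⁻ M : Matrix (Fin k) (Fin N) 𝔽, F M := by
  have h := lintegral_mul_right (k := k) (by rw [modulus_unitary hU]; exact one_ne_zero) hF
  rwa [modulus_unitary hU, one_pow, ENNReal.ofReal_one, one_mul] at h

/-- Inversion of matrices is measurable: it is continuous on the open set of invertible matrices
and zero outside. -/
theorem measurable_ringInverse {N : ℕ} :
    Measurable (Ring.inverse : Matrix (Fin N) (Fin N) 𝔽 → Matrix (Fin N) (Fin N) 𝔽) := by
  classical
  have hU : {T : Matrix (Fin N) (Fin N) 𝔽 | IsUnit T} = {T | modulus T ≠ 0} :=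
    Set.ext fun T => ⟨modulus_ne_zero_of_isUnit, isUnit_of_modulus_ne_zero⟩
  have hm : MeasurableSet {T : Matrix (Fin N) (Fin N) 𝔽 | IsUnit T} := by
    rw [hU]
    exact (measurable_modulus (measurableSet_singleton (0 : ℝ))).compl
  have hc : ContinuousOn (Ring.inverse : Matrix (Fin N) (Fin N) 𝔽 → _) {T | IsUnit T} := by
    let _ : NormedRing (Matrix (Fin N) (Fin N) 𝔽) := Matrix.linftyOpNormedRing
    let _ : NormedAlgebra ℝ (Matrix (Fin N) (Fin N) 𝔽) := Matrix.linftyOpNormedAlgebra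
    have : CompleteSpace (Matrix (Fin N) (Fin N) 𝔽) := FiniteDimensional.complete ℝ _
    rintro _ ⟨u, rfl⟩
    exact (NormedRing.inverse_continuousAt u).continuousWithinAt
  have hp : (Ring.inverse : Matrix (Fin N) (Fin N) 𝔽 → _) =
      Set.piecewise {T | IsUnit T} Ring.inverse fun _ => 0 := by
    ext1 T
    by_cases hT : IsUnit T
    · rw [Set.piecewise_eq_of_mem]
      exact hT
    · rw [Set.piecewise_eq_of_notMem, Ring.inverse_non_unit _ hT]
      exact hT
  rw [hp]
  exact hc.measurable_piecewise continuousOn_const hm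

/-- Almost every `n × N` matrix with `N ≤ n` has an invertible top block. -/
theorem ae_modulus_topBlock_ne_zero {n N : ℕ} (h : N ≤ n) :
    ∀ᵐ M : Matrix (Fin n) (Fin N) 𝔽, modulus ((stdFrame 𝔽 h)ᴴ * M) ≠ 0 := by
  let E := stdFrame 𝔽 h
  let p : Matrix (Fin n) (Fin N) 𝔽 → ℝ → Prop := fun M t => modulus (Eᴴ * (M + t • E)) ≠ 0
  -- for fixed `M` only finitely many `t` are excluded, being eigenvalues up to the sign
  have h1 : ∀ M, ∀ᵐ t : ℝ, p M t := by
    intro M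
    have hfin : {t : ℝ | ¬ p M t}.Finite := by
      refine ((Module.End.finite_hasEigenvalue (mulVecReal (Eᴴ * M))).preimage
        neg_injective.injOn).subset fun t ht => ?_
      have ht' : modulus (Eᴴ * (M + t • E)) = 0 := not_not.1 ht
      have heq : mulVecReal (Eᴴ * (M + t • E)) =
          mulVecReal (Eᴴ * M) - (-t) • (1 : Module.End ℝ (Fin N → 𝔽)) := by
        refine LinearMap.ext fun v => ?_
        simp [Matrix.mul_add, E, conjTranspose_mul_stdFrame, Matrix.add_mulVec,
          Matrix.smul_mulVec]
      rw [modulus, abs_eq_zero, heq] at ht'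
      have := LinearMap.bot_lt_ker_of_det_eq_zero ht'
      rw [Set.mem_preimage, Set.mem_ofPred_eq, Module.End.hasEigenvalue_iff,
        Module.End.eigenspace_def]
      exact this.ne'
    exact hfin.measure_zero _
  have hcont : Continuous fun x : Matrix (Fin n) (Fin N) 𝔽 × ℝ =>
      modulus (Eᴴ * (x.1 + x.2 • E)) :=
    continuous_modulus.comp (continuous_const.matrix_mul
      (continuous_fst.add (continuous_snd.smul continuous_const)))
  have hmeas : MeasurableSet {x : Matrix (Fin n) (Fin N) 𝔽 × ℝ | p x.1 x.2} :=
    (hcont.measurable (measurableSet_singleton (0 : ℝ))).compl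
  obtain ⟨t, ht⟩ := ((Measure.ae_ae_comm hmeas).1 (ae_of_all volume h1)).exists
  have hmp : MeasurePreserving (fun M : Fin n → Fin N → 𝔽 => M + -(t • (show Fin n → Fin N → 𝔽 from E))) :=
    measurePreserving_add_right volume _
  filter_upwards [hmp.quasiMeasurePreserving.ae ht] with M hM
  have h2 : M + -(t • E) + t • E = M := neg_add_cancel_right _ _
  change modulus (Eᴴ * (M + -(t • E) + t • E)) ≠ 0 at hM
  rwa [h2] at hM

/-- If `U [T; 0]` has modulus zero then so have `T` and the top block, which is a multiple of `T`. -/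
theorem ae_rectModulus_ne_zero {n N : ℕ} (h : N ≤ n) :
    ∀ᵐ M : Matrix (Fin n) (Fin N) 𝔽, rectModulus M ≠ 0 := by
  filter_upwards [ae_modulus_topBlock_ne_zero h] with M hM h0
  obtain ⟨u, T, rfl⟩ := exists_eq_unitary_mul h M
  have hu : u.1ᴴ * u.1 = 1 := (Unitary.mem_iff.1 u.2).1
  rw [Matrix.mul_assoc, rectModulus_isometry_mul hu,
    rectModulus_isometry_mul (conjTranspose_mul_stdFrame h), rectModulus_eq_modulus] at h0
  rw [← Matrix.mul_assoc, modulus_mul, h0, mul_zero] at hM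
  exact hM rfl

end ChangeOfVariables

/-! ### Gaussian integrals -/

section Gaussian

set_option linter.unusedSectionVars false

theorem lintegral_fin_cons {X : Type*} [MeasureSpace X] [SigmaFinite (volume : Measure X)] {k : ℕ}
    {F : (Fin (k + 1) → X) → ENNReal} (hF : Measurable F) :
    ∫⁻ v, F v = ∫⁻ x, ∫⁻ w : Fin k → X, F (Fin.cons x w) := by
  have hp := (volume_preserving_piFinSuccAbove (fun _ : Fin (k + 1) => X) 0).symm
  have he : ∀ p : X × (Fin k → X),
      (MeasurableEquiv.piFinSuccAbove (fun _ : Fin (k + 1) => X) 0).symm p = Fin.cons p.1 p.2 :=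
    fun p => by simp [MeasurableEquiv.piFinSuccAbove, Fin.insertNthEquiv]
  have hm : Measurable fun p : X × (Fin k → X) => F (Fin.cons p.1 p.2) := by
    simp_rw [← he]
    exact hF.comp (MeasurableEquiv.measurable _)
  rw [← hp.lintegral_comp hF]
  simp_rw [he]
  exact lintegral_prod _ hm.aemeasurable

theorem lintegral_prod_eq_one {X : Type*} [MeasureSpace X] [SigmaFinite (volume : Measure X)]
    {f : X → ENNReal} (hf : Measurable f) (h1 : ∫⁻ x, f x = 1) :
    ∀ k : ℕ, ∫⁻ v : Fin k → X, ∏ i, f (v i) = 1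
  | 0 => by simp [volume_pi]
  | k + 1 => by
    have hm : ∀ k, Measurable fun v : Fin k → X => ∏ i, f (v i) := fun k =>
      Finset.measurable_prod _ fun i _ => hf.comp (measurable_pi_apply i)
    rw [lintegral_fin_cons (hm _)]
    simp_rw [Fin.prod_univ_succ, Fin.cons_zero, Fin.cons_succ]
    simp_rw [lintegral_const_mul _ (hm k), lintegral_prod_eq_one hf h1 k, mul_one, h1]

theorem integral_rpow_mul_gaussian {d : ℕ} (hd : 0 < d) :
    ∫ y in Set.Ioi (0 : ℝ), y ^ ((d : ℝ) - 1) * Real.exp (-Real.pi * y ^ 2) =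
      (sphereArea d)⁻¹ := by
  have h := integral_rpow_mul_exp_neg_mul_rpow (p := 2) (q := (d : ℝ) - 1) (b := Real.pi)
    two_pos (by have : (0 : ℝ) < d := by exact_mod_cast hd
                linarith) Real.pi_pos
  simp_rw [Real.rpow_two] at h
  rw [h, sphereArea, sub_add_cancel, neg_div, Real.rpow_neg Real.pi_pos.le, inv_div]
  field_simp

theorem sphereArea_pos {d : ℕ} (hd : 0 < d) : 0 < sphereArea d := by
  have : (0 : ℝ) < d := by exact_mod_cast hd
  have := Real.Gamma_pos_of_pos (half_pos this)
  unfold sphereArea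
  positivity

/-- Polar coordinates: a radial Gaussian moment in a normed space in which the Gaussian density is
normalized. -/
theorem lintegral_norm_pow_mul_gaussian {E : Type*} [NormedAddCommGroup E] [NormedSpace ℝ E]
    [FiniteDimensional ℝ E] [Nontrivial E] [MeasurableSpace E] [BorelSpace E] (μ : Measure E)
    [μ.IsAddHaarMeasure] (h1 : ∫⁻ x, ENNReal.ofReal (Real.exp (-Real.pi * ‖x‖ ^ 2)) ∂μ = 1)
    (k : ℕ) :
    ∫⁻ x, ENNReal.ofReal (‖x‖ ^ k * Real.exp (-Real.pi * ‖x‖ ^ 2)) ∂μ =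
      ENNReal.ofReal (sphereArea (Module.finrank ℝ E) /
        sphereArea (Module.finrank ℝ E + k)) := by
  have hd : 0 < Module.finrank ℝ E := Module.finrank_pos
  have hcongr : ∀ k : ℕ, ∀ y ∈ Set.Ioi (0 : ℝ), y ^ (Module.finrank ℝ E - 1) •
      (y ^ k * Real.exp (-Real.pi * y ^ 2)) =
      y ^ (((Module.finrank ℝ E + k : ℕ) : ℝ) - 1) * Real.exp (-Real.pi * y ^ 2) := by
    intro k y hy
    rw [smul_eq_mul, ← mul_assoc, ← pow_add, ← Real.rpow_natCast]
    congr 2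
    push_cast [Nat.cast_sub (show 1 ≤ Module.finrank ℝ E from hd)]
    ring
  have hint : ∀ k : ℕ, Integrable (fun x : E => ‖x‖ ^ k * Real.exp (-Real.pi * ‖x‖ ^ 2)) μ := by
    intro k
    refine (integrable_fun_norm_addHaar μ
      (f := fun y => y ^ k * Real.exp (-Real.pi * y ^ 2))).2 ?_
    refine (integrableOn_congr_fun (hcongr k) measurableSet_Ioi).2 ?_
    refine integrableOn_rpow_mul_exp_neg_mul_sq Real.pi_pos ?_
    have : (0 : ℝ) < (Module.finrank ℝ E + k : ℕ) := by exact_mod_cast Nat.add_pos_left hd k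
    linarith
  have hval : ∀ k : ℕ, ∫ x, ‖x‖ ^ k * Real.exp (-Real.pi * ‖x‖ ^ 2) ∂μ =
      (Module.finrank ℝ E * μ.real (Metric.ball 0 1)) *
        (sphereArea (Module.finrank ℝ E + k))⁻¹ := by
    intro k
    rw [integral_fun_norm_addHaar μ (fun y => y ^ k * Real.exp (-Real.pi * y ^ 2)),
      setIntegral_congr_fun measurableSet_Ioi (hcongr k),
      integral_rpow_mul_gaussian (Nat.add_pos_left hd k), nsmul_eq_mul, smul_eq_mul, mul_assoc]
  -- the total mass one determines the volume of the unit ball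
  have h0 := hval 0
  have h2 : ∫ x, ‖x‖ ^ 0 * Real.exp (-Real.pi * ‖x‖ ^ 2) ∂μ = 1 := by
    rw [integral_eq_lintegral_of_nonneg_ae (ae_of_all _ fun x => by positivity)
      (hint 0).aestronglyMeasurable]
    simp_rw [pow_zero, one_mul, h1, ENNReal.toReal_one]
  have hs := sphereArea_pos hd
  rw [h2, add_zero, eq_comm, mul_inv_eq_iff_eq_mul₀ hs.ne', one_mul] at h0
  rw [← ofReal_integral_eq_lintegral_ofReal (hint k) (ae_of_all _ fun x => by positivity),
    hval k, h0, div_eq_mul_inv]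

variable {𝔽 : Type} [NormedDivisionRing 𝔽] [StarRing 𝔽] [NormedAlgebra ℝ 𝔽] [HermitianScalar 𝔽]
  [FiniteDimensional ℝ 𝔽] [ContinuousStar 𝔽] [MeasureSpace 𝔽] [BorelSpace 𝔽]
  [(volume : Measure 𝔽).IsAddHaarMeasure] [SecondCountableTopology 𝔽] [MilesScalar 𝔽] {n N : ℕ}

theorem ofReal_exp_neg_pi_mul_sum {k : ℕ} (a : Fin k → ℝ) :
    ENNReal.ofReal (Real.exp (-Real.pi * ∑ i, a i)) =
      ∏ i, ENNReal.ofReal (Real.exp (-Real.pi * a i)) := by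
  rw [Finset.mul_sum, Real.exp_sum, ENNReal.ofReal_prod_of_nonneg fun i _ => Real.exp_nonneg _]

theorem measurable_gaussian_vector {k : ℕ} : Measurable fun v : Fin k → 𝔽 =>
    ENNReal.ofReal (Real.exp (-Real.pi * ∑ i, ‖v i‖ ^ 2)) := by
  fun_prop

theorem lintegral_gaussian_vector (k : ℕ) :
    ∫⁻ v : Fin k → 𝔽, ENNReal.ofReal (Real.exp (-Real.pi * ∑ i, ‖v i‖ ^ 2)) = 1 := by
  simp_rw [ofReal_exp_neg_pi_mul_sum]
  exact lintegral_prod_eq_one (by fun_prop) MilesScalar.lintegral_gaussian k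

/-- The standard Gaussian density `exp (-π tr M† M)`. -/
def gaussianDensity (M : Matrix (Fin n) (Fin N) 𝔽) : ENNReal :=
  ENNReal.ofReal (Real.exp (-Real.pi * frobSq M))

theorem measurable_gaussianDensity :
    Measurable (gaussianDensity : Matrix (Fin n) (Fin N) 𝔽 → ENNReal) :=
  (measurable_frobSq.const_mul _).exp.ennreal_ofReal

theorem lintegral_gaussianDensity :
    ∫⁻ M : Matrix (Fin n) (Fin N) 𝔽, gaussianDensity M = 1 := by
  have h : ∀ M : Matrix (Fin n) (Fin N) 𝔽, gaussianDensity M =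
      ∏ i, ENNReal.ofReal (Real.exp (-Real.pi * ∑ j, ‖M i j‖ ^ 2)) := fun M => by
    rw [gaussianDensity, frobSq, Finset.sum_comm, ofReal_exp_neg_pi_mul_sum]
  simp_rw [h]
  exact lintegral_prod_eq_one measurable_gaussian_vector (lintegral_gaussian_vector N) n

/-- The radial moments of the Gaussian measure on `𝔽ᵏ` are quotients of sphere areas. -/
theorem lintegral_norm_pow_gaussian_vector (k m : ℕ) :
    ∫⁻ v : Fin (k + 1) → 𝔽, ENNReal.ofReal (Real.sqrt (∑ i, ‖v i‖ ^ 2) ^ (beta 𝔽 * m) *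
        Real.exp (-Real.pi * ∑ i, ‖v i‖ ^ 2)) =
      ENNReal.ofReal (sphereArea (beta 𝔽 * (k + 1)) / sphereArea (beta 𝔽 * (k + 1 + m))) := by
  let e : (Fin (k + 1) → 𝔽) ≃L[ℝ] PiLp 2 (fun _ : Fin (k + 1) => 𝔽) :=
    (PiLp.continuousLinearEquiv 2 ℝ fun _ : Fin (k + 1) => 𝔽).symm
  have hvol : (volume : Measure (Fin (k + 1) → 𝔽)).IsAddHaarMeasure :=
    Measure.pi.isAddHaarMeasure fun _ => volume
  let μ : Measure (PiLp 2 fun _ : Fin (k + 1) => 𝔽) := Measure.map e volume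
  have hμ : μ.IsAddHaarMeasure := e.isAddHaarMeasure_map volume
  have hnorm : ∀ v, ‖e v‖ = Real.sqrt (∑ i, ‖v i‖ ^ 2) := fun v => by
    rw [PiLp.norm_eq_of_L2]
    rfl
  have hsq : ∀ v, ‖e v‖ ^ 2 = ∑ i, ‖v i‖ ^ 2 := fun v => by
    rw [hnorm, Real.sq_sqrt (by positivity)]
  have he : Measurable e := e.continuous.measurable
  have hfin : Module.finrank ℝ (PiLp 2 fun _ : Fin (k + 1) => 𝔽) = beta 𝔽 * (k + 1) := by
    rw [← e.toLinearEquiv.finrank_eq, Module.finrank_pi_fintype, Finset.sum_const,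
      Finset.card_univ, Fintype.card_fin, smul_eq_mul, mul_comm, beta]
  have h1 : ∫⁻ x, ENNReal.ofReal (Real.exp (-Real.pi * ‖x‖ ^ 2)) ∂μ = 1 := by
    rw [lintegral_map (by fun_prop) he]
    simp_rw [hsq]
    exact lintegral_gaussian_vector _
  have h2 := lintegral_norm_pow_mul_gaussian μ h1 (beta 𝔽 * m)
  rw [lintegral_map (by fun_prop) he, hfin, ← mul_add] at h2
  simp_rw [← hnorm, ← hsq]
  exact h2

end Gaussian

/-! ### Haar measure of the unitary group -/

section Invariance

set_option linter.unusedSectionVars false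

variable {𝔽 : Type} [NormedDivisionRing 𝔽] [StarRing 𝔽] [NormedAlgebra ℝ 𝔽] [HermitianScalar 𝔽]
  [FiniteDimensional ℝ 𝔽] [ContinuousStar 𝔽] [MeasureSpace 𝔽] [BorelSpace 𝔽]
  [(volume : Measure 𝔽).IsAddHaarMeasure] [SecondCountableTopology 𝔽]

instance unitaryHaar.isHaarMeasure {n : ℕ} : (unitaryHaar 𝔽 n).IsHaarMeasure := by
  unfold unitaryHaar
  infer_instance

instance unitaryHaar.isProbabilityMeasure {n : ℕ} : IsProbabilityMeasure (unitaryHaar 𝔽 n) :=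
  ⟨Measure.haarMeasure_self⟩

/-- The Haar measure of the compact unitary group is right invariant, by uniqueness of the
invariant probability measure. -/
instance unitaryHaar.isMulRightInvariant {n : ℕ} : (unitaryHaar 𝔽 n).IsMulRightInvariant := by
  refine ⟨fun u => ?_⟩
  have : IsProbabilityMeasure ((unitaryHaar 𝔽 n).map (· * u)) :=
    Measure.isProbabilityMeasure_map (measurable_mul_const u).aemeasurable
  exact Measure.isHaarMeasure_eq_of_isProbabilityMeasure _ _

theorem unitary_conjTranspose_mul_self {n : ℕ} (u : unitary (Matrix (Fin n) (Fin n) 𝔽)) :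
    u.1ᴴ * u.1 = 1 := (Unitary.mem_iff.1 u.2).1

theorem unitary_inv_mul_self {n : ℕ} (u : unitary (Matrix (Fin n) (Fin n) 𝔽)) :
    (u⁻¹).1 * u.1 = 1 := congrArg Subtype.val (inv_mul_cancel u)

theorem Measurable.matrix_mul' {α : Type*} [MeasurableSpace α] {l m n : ℕ}
    {f : α → Matrix (Fin l) (Fin m) 𝔽} {g : α → Matrix (Fin m) (Fin n) 𝔽}
    (hf : Measurable f) (hg : Measurable g) : Measurable fun x => f x * g x := by
  refine measurable_pi_iff.2 fun i => measurable_pi_iff.2 fun j => ?_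
  have hf' : ∀ k, Measurable fun x => f x i k := fun k =>
    (measurable_pi_iff.1 ((measurable_pi_iff.1 hf) i)) k
  have hg' : ∀ k, Measurable fun x => g x k j := fun k =>
    (measurable_pi_iff.1 ((measurable_pi_iff.1 hg) k)) j
  simp only [Matrix.mul_apply]
  exact Finset.measurable_sum _ fun k _ => (hf' k).mul (hg' k)

theorem Ring.inverse_mul_of_isUnit {R : Type*} [MonoidWithZero R] (S : R) {T : R}
    (hT : IsUnit T) : Ring.inverse (S * T) = Ring.inverse T * Ring.inverse S := by
  by_cases hS : IsUnit S
  · obtain ⟨S, rfl⟩ := hS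
    obtain ⟨T, rfl⟩ := hT
    rw [← Units.val_mul, Ring.inverse_unit, Ring.inverse_unit, Ring.inverse_unit, _root_.mul_inv_rev,
      Units.val_mul]
  · have hST : ¬ IsUnit (S * T) := fun h => by
      obtain ⟨T, rfl⟩ := hT
      exact hS ((Units.isUnit_mul_units S T).1 h)
    rw [Ring.inverse_non_unit _ hS, Ring.inverse_non_unit _ hST, mul_zero]

variable [MilesScalar 𝔽] {n N : ℕ}

/-! ### The averaged integral is a multiple of the Lebesgue integral -/

/-- The integral of `g (U M T) |T| ^ (n - N)` over unitary `U` and square matrices `T`, where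
`|T|` is the modulus. The exponent is a difference of natural numbers, meant for `N ≤ n`. -/
def orbitIntegral (g : Matrix (Fin n) (Fin N) 𝔽 → ENNReal) (M : Matrix (Fin n) (Fin N) 𝔽) :
    ENNReal :=
  ∫⁻ u, (∫⁻ T : Matrix (Fin N) (Fin N) 𝔽,
    ENNReal.ofReal (modulus T ^ (n - N)) * g (u.1 * M * T)) ∂unitaryHaar 𝔽 n

theorem measurable_unitary_coe {n : ℕ} :
    Measurable (fun u : unitary (Matrix (Fin n) (Fin n) 𝔽) => u.1) := measurable_subtype_coe

/-- All orbits of full rank matrices have the same integral, up to the modulus. -/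
theorem orbitIntegral_eq {g : Matrix (Fin n) (Fin N) 𝔽 → ENNReal} (hg : Measurable g)
    {M : Matrix (Fin n) (Fin N) 𝔽} (hM : rectModulus M ≠ 0) (h : N ≤ n) :
    ENNReal.ofReal (rectModulus M ^ n) * orbitIntegral g M = orbitIntegral g (stdFrame 𝔽 h) := by
  obtain ⟨u₀, T₀, rfl⟩ := exists_eq_unitary_mul h M
  have hρ : rectModulus (u₀.1 * stdFrame 𝔽 h * T₀) = modulus T₀ := by
    rw [Matrix.mul_assoc, rectModulus_isometry_mul (unitary_conjTranspose_mul_self u₀),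
      rectModulus_isometry_mul (conjTranspose_mul_stdFrame h), rectModulus_eq_modulus]
  rw [hρ] at hM ⊢
  have h1 := lintegral_mul_right_eq_self (μ := unitaryHaar 𝔽 n) (fun u =>
    ∫⁻ T : Matrix (Fin N) (Fin N) 𝔽,
      ENNReal.ofReal (modulus T ^ (n - N)) * g (u.1 * (stdFrame 𝔽 h * T₀) * T)) u₀
  have h2 : orbitIntegral g (u₀.1 * stdFrame 𝔽 h * T₀) =
      ∫⁻ u, (∫⁻ T : Matrix (Fin N) (Fin N) 𝔽, ENNReal.ofReal (modulus T ^ (n - N)) *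
        g (u.1 * (stdFrame 𝔽 h * T₀) * T)) ∂unitaryHaar 𝔽 n := by
    rw [← h1]
    simp only [orbitIntegral, Submonoid.coe_mul, Matrix.mul_assoc]
  rw [h2, orbitIntegral, ← lintegral_const_mul' _ _ ENNReal.ofReal_ne_top]
  refine lintegral_congr fun u => ?_
  have hm : Measurable fun S : Matrix (Fin N) (Fin N) 𝔽 =>
      ENNReal.ofReal (modulus S ^ (n - N)) * g (u.1 * stdFrame 𝔽 h * S) :=
    (measurable_modulus.pow_const _).ennreal_ofReal.mul
      (hg.comp (measurable_const.matrix_mul' measurable_id))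
  rw [← lintegral_mul_left hM hm]
  have h3 : modulus T₀ ^ n = modulus T₀ ^ N * modulus T₀ ^ (n - N) := by
    rw [← pow_add]
    congr 1
    omega
  rw [h3, ENNReal.ofReal_mul (pow_nonneg (modulus_nonneg _) _), mul_assoc,
    ← lintegral_const_mul' _ _ ENNReal.ofReal_ne_top]
  congr 1
  refine lintegral_congr fun T => ?_
  rw [modulus_mul, mul_pow, ENNReal.ofReal_mul (pow_nonneg (modulus_nonneg _) _), mul_assoc]
  simp only [Matrix.mul_assoc]

/-- The integral of `f (U⁻¹ M T⁻¹) |T| ^ (-N)` over unitary `U` and square matrices `T`. The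
singular `T`, to which `Ring.inverse` gives the value zero, form a null set. -/
def dualOrbitIntegral (f : Matrix (Fin n) (Fin N) 𝔽 → ENNReal)
    (M : Matrix (Fin n) (Fin N) 𝔽) : ENNReal :=
  ∫⁻ u, (∫⁻ T : Matrix (Fin N) (Fin N) 𝔽,
    (ENNReal.ofReal (modulus T ^ N))⁻¹ * f ((u⁻¹).1 * M * Ring.inverse T)) ∂unitaryHaar 𝔽 n

/-- All orbits of full rank matrices have the same dual integral: the measure `|T| ^ (-N) dT` is
invariant under `T ↦ T T₀`. -/
theorem dualOrbitIntegral_eq {f : Matrix (Fin n) (Fin N) 𝔽 → ENNReal} (hf : Measurable f)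
    {M : Matrix (Fin n) (Fin N) 𝔽} (hM : rectModulus M ≠ 0)
    (h : N ≤ n) [StarModule ℝ 𝔽] :
    dualOrbitIntegral f M = dualOrbitIntegral f (stdFrame 𝔽 h) := by
  obtain ⟨u₀, T₀, rfl⟩ := exists_eq_unitary_mul h M
  have hρ : rectModulus (u₀.1 * stdFrame 𝔽 h * T₀) = modulus T₀ := by
    rw [Matrix.mul_assoc, rectModulus_isometry_mul (unitary_conjTranspose_mul_self u₀),
      rectModulus_isometry_mul (conjTranspose_mul_stdFrame h), rectModulus_eq_modulus]
  rw [hρ] at hM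
  have h1 := lintegral_mul_left_eq_self (μ := unitaryHaar 𝔽 n) (fun u =>
    ∫⁻ T : Matrix (Fin N) (Fin N) 𝔽, (ENNReal.ofReal (modulus T ^ N))⁻¹ *
      f ((u⁻¹).1 * (stdFrame 𝔽 h * T₀) * Ring.inverse T)) u₀⁻¹
  have h2 : dualOrbitIntegral f (u₀.1 * stdFrame 𝔽 h * T₀) =
      ∫⁻ u, (∫⁻ T : Matrix (Fin N) (Fin N) 𝔽, (ENNReal.ofReal (modulus T ^ N))⁻¹ *
        f ((u⁻¹).1 * (stdFrame 𝔽 h * T₀) * Ring.inverse T)) ∂unitaryHaar 𝔽 n := by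
    rw [← h1]
    simp only [dualOrbitIntegral, _root_.mul_inv_rev, inv_inv, Submonoid.coe_mul, Matrix.mul_assoc]
  rw [h2, dualOrbitIntegral]
  refine lintegral_congr fun u => ?_
  have hm : Measurable fun T : Matrix (Fin N) (Fin N) 𝔽 =>
      (ENNReal.ofReal (modulus T ^ N))⁻¹ *
        f ((u⁻¹).1 * (stdFrame 𝔽 h * T₀) * Ring.inverse T) :=
    (measurable_modulus.pow_const _).ennreal_ofReal.inv.mul
      (hf.comp (measurable_const.matrix_mul' measurable_ringInverse))
  rw [← lintegral_mul_right hM hm, ← lintegral_const_mul' _ _ ENNReal.ofReal_ne_top]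
  refine lintegral_congr fun S => ?_
  have hT₀ := isUnit_of_modulus_ne_zero hM
  have hpos : 0 < modulus T₀ ^ N := pow_pos ((modulus_nonneg _).lt_of_ne' hM) _
  have h0 : ENNReal.ofReal (modulus T₀ ^ N) ≠ 0 := (ENNReal.ofReal_pos.2 hpos).ne'
  rw [Ring.inverse_mul_of_isUnit S hT₀, modulus_mul, mul_pow,
    ENNReal.ofReal_mul (pow_nonneg (modulus_nonneg _) _),
    ENNReal.mul_inv (Or.inr ENNReal.ofReal_ne_top) (Or.inl ENNReal.ofReal_ne_top),
    mul_comm (ENNReal.ofReal (modulus S ^ N))⁻¹, mul_assoc, ← mul_assoc,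
    ENNReal.mul_inv_cancel h0 ENNReal.ofReal_ne_top, one_mul]
  congr 2
  rw [← Matrix.mul_assoc, ← Matrix.mul_assoc, Matrix.mul_assoc _ T₀,
    Ring.mul_inverse_cancel _ hT₀, Matrix.mul_one]

theorem ae_modulus_ne_zero :
    ∀ᵐ T : Matrix (Fin N) (Fin N) 𝔽, modulus T ≠ 0 := by
  filter_upwards [ae_rectModulus_ne_zero (le_refl N)] with T hT
  rwa [← rectModulus_eq_modulus]

/-- Tonelli's theorem and the substitution `M ↦ U M T` exchange the two orbit integrals. -/
theorem lintegral_mul_orbitIntegral [StarModule ℝ 𝔽] {f g : Matrix (Fin n) (Fin N) 𝔽 → ENNReal}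
    (hf : Measurable f) (hg : Measurable g) (h : N ≤ n) :
    ∫⁻ M, f M * orbitIntegral g M = ∫⁻ M, g M * dualOrbitIntegral f M := by
  let ν := (unitaryHaar 𝔽 n).prod (volume : Measure (Matrix (Fin N) (Fin N) 𝔽))
  have hmul : Measurable fun x : Matrix (Fin n) (Fin N) 𝔽 ×
      (unitary (Matrix (Fin n) (Fin n) 𝔽) × Matrix (Fin N) (Fin N) 𝔽) =>
      x.2.1.1 * x.1 * x.2.2 :=
    ((measurable_unitary_coe.comp (measurable_fst.comp measurable_snd)).matrix_mul'
      measurable_fst).matrix_mul' (measurable_snd.comp measurable_snd)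
  have hmul' : Measurable fun x : Matrix (Fin n) (Fin N) 𝔽 ×
      (unitary (Matrix (Fin n) (Fin n) 𝔽) × Matrix (Fin N) (Fin N) 𝔽) =>
      (x.2.1⁻¹).1 * x.1 * Ring.inverse x.2.2 :=
    ((measurable_unitary_coe.comp (measurable_fst.comp measurable_snd).inv).matrix_mul'
      measurable_fst).matrix_mul' (measurable_ringInverse.comp (measurable_snd.comp measurable_snd))
  have hw : Measurable fun x : Matrix (Fin n) (Fin N) 𝔽 ×
      (unitary (Matrix (Fin n) (Fin n) 𝔽) × Matrix (Fin N) (Fin N) 𝔽) => modulus x.2.2 :=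
    measurable_modulus.comp (measurable_snd.comp measurable_snd)
  have hl : Measurable fun x : Matrix (Fin n) (Fin N) 𝔽 ×
      (unitary (Matrix (Fin n) (Fin n) 𝔽) × Matrix (Fin N) (Fin N) 𝔽) =>
      ENNReal.ofReal (modulus x.2.2 ^ (n - N)) * g (x.2.1.1 * x.1 * x.2.2) :=
    (hw.pow_const _).ennreal_ofReal.mul (hg.comp hmul)
  have hr : Measurable fun x : Matrix (Fin n) (Fin N) 𝔽 ×
      (unitary (Matrix (Fin n) (Fin n) 𝔽) × Matrix (Fin N) (Fin N) 𝔽) =>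
      (ENNReal.ofReal (modulus x.2.2 ^ N))⁻¹ *
        f ((x.2.1⁻¹).1 * x.1 * Ring.inverse x.2.2) :=
    (hw.pow_const _).ennreal_ofReal.inv.mul (hf.comp hmul')
  have e1 : ∀ M, f M * orbitIntegral g M = ∫⁻ p, f M *
      (ENNReal.ofReal (modulus p.2 ^ (n - N)) * g (p.1.1 * M * p.2)) ∂ν := by
    intro M
    have hlM : Measurable fun p : unitary (Matrix (Fin n) (Fin n) 𝔽) × Matrix (Fin N) (Fin N) 𝔽 =>
        ENNReal.ofReal (modulus p.2 ^ (n - N)) * g (p.1.1 * M * p.2) :=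
      ((measurable_modulus.comp measurable_snd).pow_const _).ennreal_ofReal.mul
        (hg.comp (((measurable_unitary_coe.comp measurable_fst).matrix_mul'
          measurable_const).matrix_mul' measurable_snd))
    rw [lintegral_const_mul _ hlM, orbitIntegral, lintegral_prod _ hlM.aemeasurable]
  have e2 : ∀ M, g M * dualOrbitIntegral f M = ∫⁻ p, g M *
      ((ENNReal.ofReal (modulus p.2 ^ N))⁻¹ *
        f ((p.1⁻¹).1 * M * Ring.inverse p.2)) ∂ν := by
    intro M
    have hrM : Measurable fun p : unitary (Matrix (Fin n) (Fin n) 𝔽) × Matrix (Fin N) (Fin N) 𝔽 =>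
        (ENNReal.ofReal (modulus p.2 ^ N))⁻¹ * f ((p.1⁻¹).1 * M * Ring.inverse p.2) :=
      ((measurable_modulus.comp measurable_snd).pow_const _).ennreal_ofReal.inv.mul
        (hf.comp (((measurable_unitary_coe.comp measurable_fst.inv).matrix_mul'
          measurable_const).matrix_mul' (measurable_ringInverse.comp measurable_snd)))
    rw [lintegral_const_mul _ hrM, dualOrbitIntegral, lintegral_prod _ hrM.aemeasurable]
  simp_rw [e1, e2]
  rw [lintegral_lintegral_swap ((hf.comp measurable_fst).mul hl).aemeasurable]
  conv_rhs => rw [lintegral_lintegral_swap ((hg.comp measurable_fst).mul hr).aemeasurable]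
  have hae : ∀ᵐ p ∂ν, modulus p.2 ≠ 0 :=
    Measure.quasiMeasurePreserving_snd.ae ae_modulus_ne_zero
  refine lintegral_congr_ae ?_
  filter_upwards [hae] with p hp
  obtain ⟨u, T⟩ := p
  replace hp : modulus T ≠ 0 := hp
  have hT := isUnit_of_modulus_ne_zero hp
  have hpos : 0 < modulus T := (modulus_nonneg _).lt_of_ne' hp
  let F : Matrix (Fin n) (Fin N) 𝔽 → ENNReal := fun M =>
    g M * f ((u⁻¹).1 * M * Ring.inverse T)
  have hF : Measurable F := hg.mul (hf.comp
    ((measurable_const.matrix_mul' measurable_id).matrix_mul' measurable_const))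
  have hFu : Measurable fun M : Matrix (Fin n) (Fin N) 𝔽 => F (M * T) :=
    hF.comp (measurable_id.matrix_mul' measurable_const)
  have hsub : ∫⁻ M, F M = ENNReal.ofReal (modulus T ^ n) * ∫⁻ M, f M * g (u.1 * M * T) := by
    rw [← lintegral_mul_right hp hF,
      ← lintegral_unitary_mul (unitary_conjTranspose_mul_self u) hFu]
    congr 1
    refine lintegral_congr fun M => ?_
    have : (u⁻¹).1 * (u.1 * M * T) * Ring.inverse T = M := by
      rw [← Matrix.mul_assoc, ← Matrix.mul_assoc, unitary_inv_mul_self, Matrix.one_mul,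
        Matrix.mul_assoc, Ring.mul_inverse_cancel _ hT, Matrix.mul_one]
    simp only [F, this, mul_comm]
  have hn : ENNReal.ofReal (modulus T ^ n) =
      ENNReal.ofReal (modulus T ^ N) * ENNReal.ofReal (modulus T ^ (n - N)) := by
    rw [← ENNReal.ofReal_mul (pow_nonneg hpos.le _), ← pow_add]
    congr 2
    omega
  have h0 : ENNReal.ofReal (modulus T ^ N) ≠ 0 := (ENNReal.ofReal_pos.2 (pow_pos hpos _)).ne'
  calc ∫⁻ M, f M * (ENNReal.ofReal (modulus T ^ (n - N)) * g (u.1 * M * T))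
      = ENNReal.ofReal (modulus T ^ (n - N)) * ∫⁻ M, f M * g (u.1 * M * T) := by
        rw [← lintegral_const_mul' _ _ ENNReal.ofReal_ne_top]
        exact lintegral_congr fun M => mul_left_comm _ _ _
    _ = (ENNReal.ofReal (modulus T ^ N))⁻¹ * ∫⁻ M, F M := by
        rw [hsub, hn, ← mul_assoc, ← mul_assoc,
          ENNReal.inv_mul_cancel h0 ENNReal.ofReal_ne_top, one_mul]
    _ = _ := by
        rw [← lintegral_const_mul' _ _ (ENNReal.inv_ne_top.2 h0)]
        exact lintegral_congr fun M => mul_left_comm _ _ _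

/-- Averaging over the orbit of `[1; 0]` is proportional to Lebesgue measure; the constant is
found by inserting the Gaussian density. -/
theorem orbitIntegral_stdFrame [StarModule ℝ 𝔽] (h : N ≤ n)
    {g : Matrix (Fin n) (Fin N) 𝔽 → ENNReal} (hg : Measurable g) :
    orbitIntegral g (stdFrame 𝔽 h) =
      (∫⁻ M, g M) * orbitIntegral gaussianDensity (stdFrame 𝔽 h) := by
  -- the power of the modulus cancels the one in `orbitIntegral_eq`, leaving a density of mass one
  let f : Matrix (Fin n) (Fin N) 𝔽 → ENNReal := fun M =>
    gaussianDensity M * ENNReal.ofReal (rectModulus M ^ n)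
  have hf : Measurable f := measurable_gaussianDensity.mul
    (measurable_rectModulus.pow_const _).ennreal_ofReal
  have key : ∀ {g : Matrix (Fin n) (Fin N) 𝔽 → ENNReal}, Measurable g →
      orbitIntegral g (stdFrame 𝔽 h) = (∫⁻ M, g M) * dualOrbitIntegral f (stdFrame 𝔽 h) := by
    intro g hg
    have h1 : ∫⁻ M, f M * orbitIntegral g M = orbitIntegral g (stdFrame 𝔽 h) := by
      have : ∀ᵐ M : Matrix (Fin n) (Fin N) 𝔽, f M * orbitIntegral g M =
          gaussianDensity M * orbitIntegral g (stdFrame 𝔽 h) := by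
        filter_upwards [ae_rectModulus_ne_zero h] with M hM
        rw [← orbitIntegral_eq hg hM h, ← mul_assoc]
      rw [lintegral_congr_ae this, lintegral_mul_const _ measurable_gaussianDensity,
        lintegral_gaussianDensity, one_mul]
    have h2 : ∫⁻ M, g M * dualOrbitIntegral f M =
        (∫⁻ M, g M) * dualOrbitIntegral f (stdFrame 𝔽 h) := by
      rw [← lintegral_mul_const _ hg]
      refine lintegral_congr_ae ?_
      filter_upwards [ae_rectModulus_ne_zero h] with M hM
      rw [dualOrbitIntegral_eq hf hM h]
    rw [← h1, lintegral_mul_orbitIntegral hf hg h, h2]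
  rw [key hg, key measurable_gaussianDensity, lintegral_gaussianDensity, one_mul]

end Invariance

/-! ### Moments of the modulus of a Gaussian matrix -/

section Moments

set_option linter.unusedSectionVars false

variable {𝔽 : Type} [NormedDivisionRing 𝔽] [StarRing 𝔽] [NormedAlgebra ℝ 𝔽] [HermitianScalar 𝔽]
  [FiniteDimensional ℝ 𝔽] [ContinuousStar 𝔽] [MeasureSpace 𝔽] [BorelSpace 𝔽]
  [(volume : Measure 𝔽).IsAddHaarMeasure] [SecondCountableTopology 𝔽] [MilesScalar 𝔽] {n N : ℕ}

/-- Every row vector is `(t, 0, …, 0) U` with `U` unitary. -/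
theorem exists_row_eq_mul_unitary (x : Fin (N + 1) → 𝔽) :
    ∃ (t : 𝔽) (U : Matrix (Fin (N + 1)) (Fin (N + 1)) 𝔽), Uᴴ * U = 1 ∧ U * Uᴴ = 1 ∧
      x = Pi.single 0 t ᵥ* U ∧ ‖t‖ = Real.sqrt (∑ i, ‖x i‖ ^ 2) := by
  let X : Matrix (Fin (N + 1)) (Fin 1) 𝔽 := Matrix.of fun i _ => star (x i)
  obtain ⟨u, T, hX⟩ := exists_eq_unitary_mul (Nat.le_add_left 1 N) X
  have hu : u.1ᴴ * u.1 = 1 := unitary_conjTranspose_mul_self u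
  have hu' : u.1 * u.1ᴴ = 1 := mul_eq_one_comm.1 hu
  have hfrob : frobSq X = frobSq T := by
    rw [hX, Matrix.mul_assoc, frobSq_isometry_mul hu,
      frobSq_isometry_mul (conjTranspose_mul_stdFrame _)]
  refine ⟨star (T 0 0), u.1ᴴ, by simpa using hu', by simpa using hu, ?_, ?_⟩
  · ext j
    have h1 := congrArg star (congrFun (congrFun hX j) 0)
    have h2 : ∀ i, (stdFrame 𝔽 (Nat.le_add_left 1 N)) i 0 = if i = 0 then 1 else 0 := fun i => by
      simp [stdFrame, Matrix.one_apply]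
    simpa [X, Matrix.mul_apply, h2] using h1
  · have h3 : frobSq X = ∑ i, ‖x i‖ ^ 2 := by simp [frobSq, X, norm_star_eq]
    have h4 : frobSq T = ‖T 0 0‖ ^ 2 := by simp [frobSq]
    rw [← h3, hfrob, h4, norm_star_eq, Real.sqrt_sq (norm_nonneg _)]

/-- The measure on `N × (N + 1)` matrices splits off the first column. -/
theorem lintegral_matrix_cons_col
    {G : Matrix (Fin N) (Fin (N + 1)) 𝔽 → ENNReal} (hG : Measurable G) :
    ∫⁻ M, G M = ∫⁻ y : Fin N → 𝔽, ∫⁻ B : Matrix (Fin N) (Fin N) 𝔽,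
      G (Matrix.of fun i => Fin.cons (y i) (B i)) := by
  have h1 : MeasurePreserving (fun (M : Fin N → Fin (N + 1) → 𝔽) i =>
      MeasurableEquiv.piFinSuccAbove (fun _ => 𝔽) 0 (M i)) :=
    volume_preserving_pi fun _ => volume_preserving_piFinSuccAbove (fun _ => 𝔽) 0
  have h2 := (volume_measurePreserving_arrowProdEquivProdArrow 𝔽 (Fin N → 𝔽) (Fin N)).comp h1
  have hcons : Measurable fun p : (Fin N → 𝔽) × (Fin N → Fin N → 𝔽) =>
      (Matrix.of fun i => Fin.cons (p.1 i) (p.2 i) : Matrix (Fin N) (Fin (N + 1)) 𝔽) := by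
    refine measurable_pi_iff.2 fun i => measurable_pi_iff.2 fun j => ?_
    refine Fin.cases ?_ (fun j => ?_) j
    · exact (measurable_pi_apply i).comp measurable_fst
    · exact (measurable_pi_apply j).comp ((measurable_pi_apply i).comp measurable_snd)
  have h3 := h2.lintegral_comp (hG.comp hcons)
  rw [Measure.volume_eq_prod, lintegral_prod _ (hG.comp hcons).aemeasurable] at h3
  refine Eq.trans (lintegral_congr fun M => ?_) h3
  simp only [Function.comp_apply]
  congr 1
  ext i j
  refine Fin.cases ?_ (fun j => ?_) j <;> rfl

/-- The integrand of the moment of order `m` of the modulus of a square Gaussian matrix. -/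
def momentDensity (m : ℕ) (M : Matrix (Fin N) (Fin N) 𝔽) : ENNReal :=
  gaussianDensity M * ENNReal.ofReal (modulus M ^ m)

theorem measurable_momentDensity (m : ℕ) :
    Measurable (momentDensity m : Matrix (Fin N) (Fin N) 𝔽 → ENNReal) :=
  measurable_gaussianDensity.mul (measurable_modulus.pow_const m).ennreal_ofReal

theorem momentDensity_mul_unitary (m : ℕ) (M : Matrix (Fin N) (Fin N) 𝔽)
    {U : Matrix (Fin N) (Fin N) 𝔽} (hU : Uᴴ * U = 1) (hU' : U * Uᴴ = 1) :
    momentDensity m (M * U) = momentDensity m M := by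
  rw [momentDensity, gaussianDensity, frobSq_mul_unitary M hU', modulus_mul, modulus_unitary hU,
    mul_one, momentDensity, gaussianDensity]

theorem frobSq_lowerBlock (t : 𝔽) (y : Fin N → 𝔽) (B : Matrix (Fin N) (Fin N) 𝔽) :
    frobSq (lowerBlock t y B) = ‖t‖ ^ 2 + ∑ i, ‖y i‖ ^ 2 + frobSq B := by
  simp [frobSq, lowerBlock, Fin.sum_univ_succ]

theorem momentDensity_lowerBlock (m : ℕ) (t : 𝔽) (y : Fin N → 𝔽)
    (B : Matrix (Fin N) (Fin N) 𝔽) :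
    momentDensity m (lowerBlock t y B) =
      ENNReal.ofReal (‖t‖ ^ (beta 𝔽 * m) * Real.exp (-Real.pi * ‖t‖ ^ 2)) *
        (ENNReal.ofReal (Real.exp (-Real.pi * ∑ i, ‖y i‖ ^ 2)) * momentDensity m B) := by
  rw [momentDensity, momentDensity, gaussianDensity, gaussianDensity, frobSq_lowerBlock,
    modulus_lowerBlock, ← ENNReal.ofReal_mul (by positivity), ← ENNReal.ofReal_mul (by positivity),
    ← ENNReal.ofReal_mul (by positivity), ← ENNReal.ofReal_mul (by positivity), mul_add, mul_add,
    Real.exp_add, Real.exp_add, mul_pow, pow_mul]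
  congr 1
  ring

/-- Rotating the first row `x` to `(|x|, 0, …, 0)` expresses the moments of the modulus of an
`(N + 1) × (N + 1)` matrix by those of an `N × N` matrix. -/
theorem lintegral_momentDensity_succ [StarModule ℝ 𝔽] (N m : ℕ) :
    ∫⁻ M : Matrix (Fin (N + 1)) (Fin (N + 1)) 𝔽, momentDensity m M =
      ENNReal.ofReal (sphereArea (beta 𝔽 * (N + 1)) / sphereArea (beta 𝔽 * (N + 1 + m))) *
        ∫⁻ M : Matrix (Fin N) (Fin N) 𝔽, momentDensity m M := by
  have hrow : ∀ x : Fin (N + 1) → 𝔽,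
      ∫⁻ M : Matrix (Fin N) (Fin (N + 1)) 𝔽, momentDensity m (Matrix.of (Fin.cons x M)) =
      ENNReal.ofReal (Real.sqrt (∑ i, ‖x i‖ ^ 2) ^ (beta 𝔽 * m) *
        Real.exp (-Real.pi * ∑ i, ‖x i‖ ^ 2)) *
        ∫⁻ M : Matrix (Fin N) (Fin N) 𝔽, momentDensity m M := by
    intro x
    obtain ⟨t, U, hU, hU', hx, ht⟩ := exists_row_eq_mul_unitary x
    have hm : ∀ x : Fin (N + 1) → 𝔽, Measurable fun M : Matrix (Fin N) (Fin (N + 1)) 𝔽 =>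
        momentDensity m (Matrix.of (Fin.cons x M)) := fun x => by
      refine (measurable_momentDensity m).comp (measurable_pi_iff.2 fun i => ?_)
      refine Fin.cases measurable_const (fun i => measurable_pi_apply i) i
    have hmul : ∀ M : Matrix (Fin N) (Fin (N + 1)) 𝔽,
        momentDensity m (Matrix.of (Fin.cons x (M * U))) =
          momentDensity m (Matrix.of (Fin.cons (Pi.single 0 t) M)) := fun M => by
      rw [← momentDensity_mul_unitary m (Matrix.of (Fin.cons (Pi.single 0 t) M)) hU hU']
      congr 1
      ext i j
      refine Fin.cases ?_ (fun i => ?_) i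
      · exact congrFun hx j
      · rfl
    rw [← lintegral_mul_unitary hU (hm x)]
    simp_rw [hmul]
    rw [lintegral_matrix_cons_col (hm _)]
    have hblock : ∀ (y : Fin N → 𝔽) (B : Matrix (Fin N) (Fin N) 𝔽),
        momentDensity m (Matrix.of (Fin.cons (Pi.single 0 t)
          (Matrix.of fun i => Fin.cons (y i) (B i) : Matrix (Fin N) (Fin (N + 1)) 𝔽))) =
        momentDensity m (lowerBlock t y B) := fun y B => rfl
    simp_rw [hblock, momentDensity_lowerBlock, lintegral_const_mul' _ _ ENNReal.ofReal_ne_top]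
    rw [lintegral_mul_const _ measurable_gaussian_vector, lintegral_gaussian_vector, one_mul, ht,
      Real.sq_sqrt (by positivity)]
  have h1 := lintegral_fin_cons (X := Fin (N + 1) → 𝔽) (k := N)
    (measurable_momentDensity (𝔽 := 𝔽) (N := N + 1) m)
  refine h1.trans ?_
  refine (lintegral_congr hrow).trans ?_
  rw [lintegral_mul_const _ (by fun_prop), lintegral_norm_pow_gaussian_vector]

/-- The moments of the modulus of an `N × N` Gaussian matrix. -/
theorem lintegral_momentDensity [StarModule ℝ 𝔽] (m : ℕ) : ∀ N : ℕ,
    ∫⁻ M : Matrix (Fin N) (Fin N) 𝔽, momentDensity m M =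
      ENNReal.ofReal (∏ i ∈ Finset.range N,
        sphereArea (beta 𝔽 * (N - i)) / sphereArea (beta 𝔽 * (N + m - i)))
  | 0 => by
    have h : ∀ M : Matrix (Fin 0) (Fin 0) 𝔽, momentDensity m M = gaussianDensity M := fun M => by
      rw [momentDensity, Subsingleton.elim M 1, modulus_one, one_pow, ENNReal.ofReal_one, mul_one]
    simp_rw [h, lintegral_gaussianDensity]
    simp
  | N + 1 => by
    have hβ : 0 < beta 𝔽 := Module.finrank_pos
    rw [lintegral_momentDensity_succ, lintegral_momentDensity m N, Finset.prod_range_succ',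
      mul_comm, ← ENNReal.ofReal_mul]
    · simp only [Nat.sub_zero, Nat.succ_sub_succ,
        Nat.add_right_comm N 1 m]
    · refine Finset.prod_nonneg fun i hi => ?_
      have hi' := Finset.mem_range.1 hi
      have h1 := sphereArea_pos (Nat.mul_pos hβ (show 0 < N - i by omega))
      have h2 := sphereArea_pos (Nat.mul_pos hβ (show 0 < N + m - i by omega))
      positivity

theorem orbitIntegral_gaussianDensity [StarModule ℝ 𝔽] (h : N ≤ n) :
    orbitIntegral gaussianDensity (stdFrame 𝔽 h) =
      ENNReal.ofReal (stiefelVolume 𝔽 N N / stiefelVolume 𝔽 n N) := by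
  have h1 : ∀ (u : unitary (Matrix (Fin n) (Fin n) 𝔽)) (T : Matrix (Fin N) (Fin N) 𝔽),
      ENNReal.ofReal (modulus T ^ (n - N)) * gaussianDensity (u.1 * stdFrame 𝔽 h * T) =
        momentDensity (n - N) T := fun u T => by
    rw [gaussianDensity, Matrix.mul_assoc, frobSq_isometry_mul (unitary_conjTranspose_mul_self u),
      frobSq_isometry_mul (conjTranspose_mul_stdFrame h), mul_comm, momentDensity, gaussianDensity]
  simp_rw [orbitIntegral, h1, lintegral_const, measure_univ, mul_one, lintegral_momentDensity,
    stiefelVolume, Finset.prod_div_distrib, Nat.add_sub_of_le h]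

theorem stiefelVolume_pos (h : N ≤ n) : 0 < stiefelVolume 𝔽 n N := by
  have hβ : 0 < beta 𝔽 := Module.finrank_pos
  refine Finset.prod_pos fun i hi => sphereArea_pos (Nat.mul_pos hβ ?_)
  have := Finset.mem_range.1 hi
  omega

/-- Integration over the orbit of `[1; 0]`, with the constant made explicit. -/
theorem lintegral_eq_orbitIntegral [StarModule ℝ 𝔽] (h : N ≤ n)
    {g : Matrix (Fin n) (Fin N) 𝔽 → ENNReal} (hg : Measurable g) :
    ∫⁻ M, g M = (ENNReal.ofReal (stiefelVolume 𝔽 N N))⁻¹ *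
      (ENNReal.ofReal (stiefelVolume 𝔽 n N) * orbitIntegral g (stdFrame 𝔽 h)) := by
  have h1 : 0 < stiefelVolume 𝔽 N N := stiefelVolume_pos le_rfl
  have h2 : 0 < stiefelVolume 𝔽 n N := stiefelVolume_pos h
  rw [orbitIntegral_stdFrame h hg, orbitIntegral_gaussianDensity, mul_left_comm _ (∫⁻ M, g M),
    ← ENNReal.ofReal_mul h2.le, mul_div_cancel₀ _ h2.ne', mul_left_comm,
    ENNReal.inv_mul_cancel (ENNReal.ofReal_pos.2 h1).ne' ENNReal.ofReal_ne_top, mul_one]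

end Moments

/-! ### The three scalar systems -/

theorem lintegral_gaussian_eq_one {V : Type*} [NormedAddCommGroup V] [InnerProductSpace ℝ V]
    [FiniteDimensional ℝ V] [MeasurableSpace V] [BorelSpace V] :
    ∫⁻ x : V, ENNReal.ofReal (Real.exp (-Real.pi * ‖x‖ ^ 2)) = 1 := by
  have h := GaussianFourier.integral_rexp_neg_mul_sq_norm (V := V) Real.pi_pos
  rw [div_self Real.pi_ne_zero, Real.one_rpow] at h
  have hint : Integrable fun x : V => Real.exp (-Real.pi * ‖x‖ ^ 2) :=
    Integrable.of_integral_ne_zero (by rw [h]; exact one_ne_zero)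
  rw [← ofReal_integral_eq_lintegral_ofReal hint (ae_of_all _ fun x => Real.exp_nonneg _), h,
    ENNReal.ofReal_one]

theorem Real.modulus_eq {N : ℕ} (M : Matrix (Fin N) (Fin N) ℝ) : modulus M = |M.det| := by
  have : mulVecReal M = Matrix.toLin' M := LinearMap.ext fun v => rfl
  rw [modulus, this, LinearMap.det_toLin']

instance Real.instMilesScalar : MilesScalar ℝ where
  hdet_nonneg M := by
    change 0 ≤ (Mᴴ * M).det
    rw [Matrix.det_mul, Matrix.det_conjTranspose, star_trivial]
    exact mul_self_nonneg _
  hdet_rpow M := by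
    change (Mᴴ * M).det ^ ((Module.finrank ℝ ℝ : ℝ) / 2) = _
    rw [Matrix.det_mul, Matrix.det_conjTranspose, star_trivial, Module.finrank_self,
      Real.modulus_eq, Nat.cast_one, ← Real.sqrt_eq_rpow, Real.sqrt_mul_self_eq_abs]
  modulus_conjTranspose M := by
    rw [Real.modulus_eq, Real.modulus_eq, Matrix.det_conjTranspose, star_trivial]
  lintegral_gaussian := lintegral_gaussian_eq_one

theorem Complex.abs_det_toLin' {ι : Type*} [Fintype ι] [DecidableEq ι] (M : Matrix ι ι ℂ) :
    |LinearMap.det ((Matrix.toLin' M).restrictScalars ℝ)| = Complex.normSq M.det := by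
  rw [LinearMap.det_restrictScalars, LinearMap.det_toLin', Algebra.norm_complex_apply,
    abs_of_nonneg (Complex.normSq_nonneg _)]

theorem Complex.det_conjTranspose_mul_self_re {ι : Type*} [Fintype ι] [DecidableEq ι]
    (M : Matrix ι ι ℂ) : (Mᴴ * M).det.re = Complex.normSq M.det := by
  rw [Matrix.det_mul, Matrix.det_conjTranspose, Complex.star_def, ← Complex.normSq_eq_conj_mul_self,
    Complex.ofReal_re]

theorem Complex.modulus_eq {N : ℕ} (M : Matrix (Fin N) (Fin N) ℂ) :
    modulus M = Complex.normSq M.det := by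
  rw [← Complex.abs_det_toLin']
  rfl

instance Complex.instMilesScalar : MilesScalar ℂ where
  hdet_nonneg M := by
    change 0 ≤ (Mᴴ * M).det.re
    rw [Complex.det_conjTranspose_mul_self_re]
    exact Complex.normSq_nonneg _
  hdet_rpow M := by
    change (Mᴴ * M).det.re ^ ((Module.finrank ℝ ℂ : ℝ) / 2) = _
    rw [Complex.det_conjTranspose_mul_self_re, Complex.finrank_real_complex, Complex.modulus_eq,
      Nat.cast_two, div_self two_ne_zero, Real.rpow_one]
  modulus_conjTranspose M := by
    rw [Complex.modulus_eq, Complex.modulus_eq, Matrix.det_conjTranspose, Complex.star_def,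
      Complex.normSq_conj]
  lintegral_gaussian := lintegral_gaussian_eq_one

namespace Quaternion

instance instStarModuleReal : StarModule ℝ ℍ[ℝ] := ⟨fun r q => by ext <;> simp⟩

theorem block_mul (p q : ℍ[ℝ]) : block (p * q) = block p * block q := by
  ext i j
  fin_cases i <;> fin_cases j <;>
    simp [block, Matrix.mul_apply, Fin.sum_univ_two, Complex.ext_iff] <;> constructor <;> ring

theorem block_sum {ι : Type*} (s : Finset ι) (f : ι → ℍ[ℝ]) :
    block (∑ i ∈ s, f i) = ∑ i ∈ s, block (f i) := by
  have hz : block 0 = 0 := by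
    ext i j
    fin_cases i <;> fin_cases j <;> simp [block, Complex.ext_iff]
  have ha : ∀ p q, block (p + q) = block p + block q := fun p q => by
    ext i j
    fin_cases i <;> fin_cases j <;> simp [block, Complex.ext_iff, add_comm]
  exact map_sum (⟨⟨block, hz⟩, ha⟩ : ℍ[ℝ] →+ Matrix (Fin 2) (Fin 2) ℂ) f s

theorem block_star (q : ℍ[ℝ]) : block (star q) = (block q)ᴴ := by
  ext i j
  fin_cases i <;> fin_cases j <;> simp [block, Complex.ext_iff]

theorem complexMatrix_mul {l m n : ℕ} (A : Matrix (Fin l) (Fin m) ℍ[ℝ])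
    (B : Matrix (Fin m) (Fin n) ℍ[ℝ]) :
    complexMatrix (A * B) = complexMatrix A * complexMatrix B := by
  ext a b
  simp only [complexMatrix, Matrix.of_apply, Matrix.mul_apply, block_sum, block_mul,
    Matrix.sum_apply, Fintype.sum_prod_type]

theorem complexMatrix_conjTranspose {m n : ℕ} (A : Matrix (Fin m) (Fin n) ℍ[ℝ]) :
    complexMatrix Aᴴ = (complexMatrix A)ᴴ := by
  ext a b
  simp only [complexMatrix, Matrix.of_apply, Matrix.conjTranspose_apply, block_star]

/-- `ℍᴺ` as the complex space `ℂ²ᴺ`: a quaternion goes to the first column of its complex block,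
so that multiplication by a quaternion becomes multiplication by its block. -/
def vectorEquiv (N : ℕ) : (Fin N → ℍ[ℝ]) ≃ₗ[ℝ] (Fin N × Fin 2 → ℂ) where
  toFun v a := block (v a.1) a.2 0
  invFun w i := ⟨(w (i, 0)).re, (w (i, 0)).im, -(w (i, 1)).re, (w (i, 1)).im⟩
  map_add' v w := by
    ext ⟨i, a⟩
    fin_cases a <;> simp [block, Complex.ext_iff, add_comm]
  map_smul' r v := by
    ext ⟨i, a⟩
    fin_cases a <;> simp [block, Complex.ext_iff]
  left_inv v := by
    ext i <;> simp [block]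
  right_inv w := by
    ext ⟨i, a⟩
    fin_cases a <;> simp [block]

theorem vectorEquiv_mulVec {N : ℕ} (M : Matrix (Fin N) (Fin N) ℍ[ℝ]) (v : Fin N → ℍ[ℝ]) :
    vectorEquiv N (M *ᵥ v) = complexMatrix M *ᵥ vectorEquiv N v := by
  ext a
  change block (∑ j, M a.1 j * v j) a.2 0 =
    ∑ b : Fin N × Fin 2, block (M a.1 b.1) a.2 b.2 * block (v b.1) b.2 0
  simp only [block_sum, block_mul, Matrix.sum_apply, Matrix.mul_apply, Fintype.sum_prod_type]

theorem modulus_eq {N : ℕ} (M : Matrix (Fin N) (Fin N) ℍ[ℝ]) :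
    modulus M = Complex.normSq (complexMatrix M).det := by
  have : (vectorEquiv N).toLinearMap ∘ₗ mulVecReal M ∘ₗ (vectorEquiv N).symm.toLinearMap =
      (Matrix.toLin' (complexMatrix M)).restrictScalars ℝ := by
    refine LinearMap.ext fun w => ?_
    simp [vectorEquiv_mulVec]
  rw [modulus, ← LinearMap.det_conj _ (vectorEquiv N), this, Complex.abs_det_toLin']

theorem hdet_conjTranspose_mul_self {N : ℕ} (M : Matrix (Fin N) (Fin N) ℍ[ℝ]) :
    HermitianScalar.hdet (Mᴴ * M) = Real.sqrt (Complex.normSq (complexMatrix M).det) := by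
  change Real.sqrt (complexMatrix (Mᴴ * M)).det.re = _
  rw [complexMatrix_mul, complexMatrix_conjTranspose, Complex.det_conjTranspose_mul_self_re]

instance instMilesScalar : MilesScalar ℍ[ℝ] where
  hdet_nonneg M := by
    rw [hdet_conjTranspose_mul_self]
    exact Real.sqrt_nonneg _
  hdet_rpow M := by
    have hβ : ((beta ℍ[ℝ] : ℕ) : ℝ) / 2 = 2 := by
      rw [beta, Quaternion.finrank_eq_four]
      norm_num
    rw [hdet_conjTranspose_mul_self, modulus_eq, hβ, Real.rpow_two,
      Real.sq_sqrt (Complex.normSq_nonneg _)]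
  modulus_conjTranspose M := by
    rw [modulus_eq, modulus_eq, complexMatrix_conjTranspose, Matrix.det_conjTranspose,
      Complex.star_def, Complex.normSq_conj]
  lintegral_gaussian := lintegral_gaussian_eq_one

end Quaternion

/-! ### Descent to the Grassmannian -/

section Descent

set_option linter.unusedSectionVars false

variable {𝔽 : Type} [NormedDivisionRing 𝔽] [StarRing 𝔽] [NormedAlgebra ℝ 𝔽] [HermitianScalar 𝔽]
  [FiniteDimensional ℝ 𝔽] [ContinuousStar 𝔽] [MeasureSpace 𝔽] [BorelSpace 𝔽]
  [(volume : Measure 𝔽).IsAddHaarMeasure] [SecondCountableTopology 𝔽] [MilesScalar 𝔽]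
  [StarModule ℝ 𝔽] {n N : ℕ}

theorem measurable_firstColumns (h : N ≤ n) :
    Measurable (firstColumns h : unitary (Matrix (Fin n) (Fin n) 𝔽) → Stiefel 𝔽 n N) := by
  refine Measurable.subtype_mk (measurable_pi_iff.2 fun i => measurable_pi_iff.2 fun j => ?_)
  exact (measurable_pi_iff.1 (measurable_pi_iff.1 measurable_unitary_coe i)) (Fin.castLE h j)

theorem measurable_stiefel_span :
    Measurable (Stiefel.span : Stiefel 𝔽 n N → Grassmannian 𝔽 n N) := fun _ hs => hs

/-- The Grassmannian carries the quotient σ-algebra, so measurability is tested on frames. -/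
theorem measurable_grassmannian_iff {γ : Type*} [MeasurableSpace γ]
    {Φ : Grassmannian 𝔽 n N → γ} : Measurable Φ ↔ Measurable fun A => Φ (Stiefel.span A) :=
  ⟨fun h => h.comp measurable_stiefel_span, fun h _ hs => h hs⟩

theorem lintegral_grassmannMeasure (h : N ≤ n) {Φ : Grassmannian 𝔽 n N → ENNReal}
    (hΦ : Measurable Φ) :
    ∫⁻ V, Φ V ∂grassmannMeasure 𝔽 h = (ENNReal.ofReal (stiefelVolume 𝔽 N N))⁻¹ *
      (ENNReal.ofReal (stiefelVolume 𝔽 n N) *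
        ∫⁻ u, Φ (firstColumns h u).span ∂unitaryHaar 𝔽 n) := by
  rw [grassmannMeasure, lintegral_smul_measure, lintegral_map hΦ measurable_stiefel_span,
    stiefelMeasure, lintegral_smul_measure,
    lintegral_map (measurable_grassmannian_iff.1 hΦ) (measurable_firstColumns h)]
  rfl

/-- The Lebesgue measure of square matrices weighted by `det (M† M) ^ (β (n - N) / 2)`. -/
def weightedVolume (𝔽 : Type) [NormedDivisionRing 𝔽] [NormedAlgebra ℝ 𝔽] [MeasureSpace 𝔽]
    (n N : ℕ) : Measure (Matrix (Fin N) (Fin N) 𝔽) :=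
  volume.withDensity fun T => ENNReal.ofReal (modulus T ^ (n - N))

theorem measurable_weight : Measurable fun T : Matrix (Fin N) (Fin N) 𝔽 =>
    ENNReal.ofReal (modulus T ^ (n - N)) := (measurable_modulus.pow_const _).ennreal_ofReal

theorem lintegral_weightedVolume {F : Matrix (Fin N) (Fin N) 𝔽 → ENNReal} (hF : Measurable F) :
    ∫⁻ T, F T ∂weightedVolume 𝔽 n N = ∫⁻ T, ENNReal.ofReal (modulus T ^ (n - N)) * F T :=
  lintegral_withDensity_eq_lintegral_mul _ measurable_weight hF

instance sFinite_weightedVolume : SFinite (weightedVolume 𝔽 n N) := by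
  unfold weightedVolume
  infer_instance

theorem map_unitary_mul_weightedVolume {W : Matrix (Fin N) (Fin N) 𝔽} (hW : Wᴴ * W = 1) :
    (weightedVolume 𝔽 n N).map (W * ·) = weightedVolume 𝔽 n N := by
  have hm : Measurable fun T : Matrix (Fin N) (Fin N) 𝔽 => W * T :=
    measurable_const.matrix_mul' measurable_id
  refine Measure.ext_of_lintegral _ fun F hF => ?_
  have hF' : Measurable fun T : Matrix (Fin N) (Fin N) 𝔽 =>
      ENNReal.ofReal (modulus T ^ (n - N)) * F T := measurable_weight.mul hF
  have hFW : Measurable fun T : Matrix (Fin N) (Fin N) 𝔽 => F (W * T) := hF.comp hm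
  rw [lintegral_map hF hm, lintegral_weightedVolume hFW, lintegral_weightedVolume hF,
    ← lintegral_unitary_mul hW hF']
  simp_rw [modulus_unitary_mul hW]

/-- The image of the weighted volume in the matrices with columns in the span of the frame `A`. -/
def frameMeasure (A : Matrix (Fin n) (Fin N) 𝔽) : Measure (Matrix (Fin n) (Fin N) 𝔽) :=
  (weightedVolume 𝔽 n N).map (A * ·)

theorem measurable_const_matrix_mul {k : ℕ} (A : Matrix (Fin n) (Fin N) 𝔽) :
    Measurable fun T : Matrix (Fin N) (Fin k) 𝔽 => A * T :=
  measurable_const.matrix_mul' measurable_id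

/-- The measure `frameMeasure A` depends only on the subspace spanned by the frame. -/
theorem frameMeasure_eq_of_columnSpan_eq {A B : Matrix (Fin n) (Fin N) 𝔽}
    (hA : Aᴴ * A = 1) (hB : Bᴴ * B = 1) (h : columnSpan A = columnSpan B) :
    frameMeasure A = frameMeasure B := by
  obtain ⟨W, hW, rfl⟩ := exists_unitary_of_columnSpan_eq hA hB h
  have : (A * W * · : Matrix (Fin N) (Fin N) 𝔽 → _) = (A * ·) ∘ (W * ·) := by
    ext1 T
    simp only [Function.comp_apply, Matrix.mul_assoc]
  rw [frameMeasure, frameMeasure, this, ← Measure.map_map (measurable_const_matrix_mul A)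
    (measurable_const_matrix_mul W), map_unitary_mul_weightedVolume hW]

theorem frameMeasure_frame {A : Grassmannian 𝔽 n N → Matrix (Fin n) (Fin N) 𝔽}
    (hA : ∀ V, IsOrthonormalFrame (A V) V) (S : Stiefel 𝔽 n N) :
    frameMeasure (A S.span) = frameMeasure S.1 :=
  frameMeasure_eq_of_columnSpan_eq (hA _).1 S.2 (hA _).2

theorem measurable_stiefel_mul :
    Measurable fun p : Stiefel 𝔽 n N × Matrix (Fin N) (Fin N) 𝔽 => p.1.1 * p.2 := by
  have h1 : Measurable fun S : Stiefel 𝔽 n N => S.1 := measurable_subtype_coe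
  exact (h1.comp measurable_fst).matrix_mul' measurable_snd

theorem lintegral_frameMeasure (A : Matrix (Fin n) (Fin N) 𝔽)
    {F : Matrix (Fin n) (Fin N) 𝔽 → ENNReal} (hF : Measurable F) :
    ∫⁻ M, F M ∂frameMeasure A = ∫⁻ T, F (A * T) ∂weightedVolume 𝔽 n N :=
  lintegral_map hF (measurable_const_matrix_mul A)

variable {A : Grassmannian 𝔽 n N → Matrix (Fin n) (Fin N) 𝔽}
  (hA : ∀ V, IsOrthonormalFrame (A V) V)
include hA

theorem measurable_lintegral_frameMeasure {F : Matrix (Fin n) (Fin N) 𝔽 → ENNReal}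
    (hF : Measurable F) : Measurable fun V => ∫⁻ M, F M ∂frameMeasure (A V) := by
  rw [measurable_grassmannian_iff]
  simp_rw [frameMeasure_frame hA, lintegral_frameMeasure _ hF]
  exact (hF.comp measurable_stiefel_mul).lintegral_prod_right'

/-- The Blaschke–Petkantschin formula for nonnegative measurable functions. -/
theorem lintegral_eq_lintegral_frameMeasure (h : N ≤ n)
    {F : Matrix (Fin n) (Fin N) 𝔽 → ENNReal} (hF : Measurable F) :
    ∫⁻ M, F M = ∫⁻ V, ∫⁻ M, F M ∂frameMeasure (A V) ∂grassmannMeasure 𝔽 h := by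
  rw [lintegral_grassmannMeasure h (measurable_lintegral_frameMeasure hA hF),
    lintegral_eq_orbitIntegral h hF, orbitIntegral]
  simp_rw [frameMeasure_frame hA, lintegral_frameMeasure _ hF, firstColumns_eq_mul]
  congr 2
  refine lintegral_congr fun u => ?_
  have hFu : Measurable fun T : Matrix (Fin N) (Fin N) 𝔽 => F (u.1 * stdFrame 𝔽 h * T) :=
    hF.comp (measurable_const_matrix_mul _)
  rw [lintegral_weightedVolume hFu]

/-- A null set of matrices is null for the measures of almost all subspaces. -/
theorem ae_ae_frameMeasure (h : N ≤ n) {p : Matrix (Fin n) (Fin N) 𝔽 → Prop}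
    (hp : ∀ᵐ M, p M) : ∀ᵐ V ∂grassmannMeasure 𝔽 h, ∀ᵐ M ∂frameMeasure (A V), p M := by
  obtain ⟨Z, hpZ, hZ, hZ0⟩ := exists_measurable_superset_of_null (ae_iff.1 hp)
  have hF : Measurable (Z.indicator (1 : Matrix (Fin n) (Fin N) 𝔽 → ENNReal)) :=
    measurable_one.indicator hZ
  have h1 := lintegral_eq_lintegral_frameMeasure hA h hF
  rw [lintegral_indicator_one hZ, hZ0, eq_comm,
    lintegral_eq_zero_iff (measurable_lintegral_frameMeasure hA hF)] at h1
  filter_upwards [h1] with V hV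
  rw [lintegral_indicator_one hZ] at hV
  exact measure_mono_null hpZ hV

/-- The Blaschke–Petkantschin formula for integrable functions, in terms of the measures
`frameMeasure`. -/
theorem integral_eq_integral_frameMeasure (h : N ≤ n) {g : Matrix (Fin n) (Fin N) 𝔽 → ℝ}
    (hg : Integrable g) :
    (∀ᵐ V ∂grassmannMeasure 𝔽 h, Integrable g (frameMeasure (A V))) ∧
      Integrable (fun V => ∫ M, g M ∂frameMeasure (A V)) (grassmannMeasure 𝔽 h) ∧
      ∫ M, g M = ∫ V, (∫ M, g M ∂frameMeasure (A V)) ∂grassmannMeasure 𝔽 h := by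
  -- it suffices to consider a measurable representative of `g`
  wlog hgm : StronglyMeasurable g generalizing g
  · let g' := hg.1.mk g
    have hgg' : g =ᵐ[volume] g' := hg.1.ae_eq_mk
    obtain ⟨h1, h2, h3⟩ := this (hg.congr hgg') hg.1.stronglyMeasurable_mk
    have hae := ae_ae_frameMeasure hA h hgg'
    have hint : (fun V => ∫ M, g M ∂frameMeasure (A V)) =ᵐ[grassmannMeasure 𝔽 h]
        fun V => ∫ M, g' M ∂frameMeasure (A V) := by
      filter_upwards [hae] with V hV
      exact integral_congr_ae hV
    refine ⟨?_, h2.congr hint.symm, ?_⟩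
    · filter_upwards [h1, hae] with V hV1 hV2
      exact hV1.congr (Filter.EventuallyEq.symm hV2)
    · rw [integral_congr_ae hgg', h3, integral_congr_ae hint]
  have hnorm := lintegral_eq_lintegral_frameMeasure hA h hgm.enorm
  have hfin : ∫⁻ V, ∫⁻ M, ‖g M‖ₑ ∂frameMeasure (A V) ∂grassmannMeasure 𝔽 h < ⊤ :=
    hnorm ▸ hg.2
  have hint : ∀ᵐ V ∂grassmannMeasure 𝔽 h, Integrable g (frameMeasure (A V)) := by
    filter_upwards [ae_lt_top (measurable_lintegral_frameMeasure hA hgm.enorm) hfin.ne] with V hV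
    exact ⟨hgm.aestronglyMeasurable, hV⟩
  have hpos : Measurable fun M => ENNReal.ofReal (g M) := hgm.measurable.ennreal_ofReal
  have hneg : Measurable fun M => ENNReal.ofReal (-g M) := hgm.measurable.neg.ennreal_ofReal
  have hP := lintegral_eq_lintegral_frameMeasure hA h hpos
  have hN := lintegral_eq_lintegral_frameMeasure hA h hneg
  have hPfin : ∫⁻ M, ENNReal.ofReal (g M) ≠ ⊤ := hg.lintegral_lt_top.ne
  have hNfin : ∫⁻ M, ENNReal.ofReal (-g M) ≠ ⊤ := hg.neg.lintegral_lt_top.ne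
  have hPm := measurable_lintegral_frameMeasure hA hpos
  have hNm := measurable_lintegral_frameMeasure hA hneg
  have hPi := integrable_toReal_of_lintegral_ne_top hPm.aemeasurable (hP ▸ hPfin)
  have hNi := integrable_toReal_of_lintegral_ne_top hNm.aemeasurable (hN ▸ hNfin)
  have hval : (fun V => ∫ M, g M ∂frameMeasure (A V)) =ᵐ[grassmannMeasure 𝔽 h]
      fun V => (∫⁻ M, ENNReal.ofReal (g M) ∂frameMeasure (A V)).toReal -
        (∫⁻ M, ENNReal.ofReal (-g M) ∂frameMeasure (A V)).toReal := by
    filter_upwards [hint] with V hV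
    exact integral_eq_lintegral_pos_part_sub_lintegral_neg_part hV
  refine ⟨hint, (hPi.sub hNi).congr hval.symm, ?_⟩
  rw [integral_congr_ae hval, integral_sub hPi hNi,
    integral_toReal hPm.aemeasurable (ae_lt_top hPm (hP ▸ hPfin)),
    integral_toReal hNm.aemeasurable (ae_lt_top hNm (hN ▸ hNfin)), ← hP, ← hN,
    integral_eq_lintegral_pos_part_sub_lintegral_neg_part hg]

omit hA in
/-- For `N ≤ n` the real power of the determinant is a natural power of the modulus. -/
theorem petkantschinIntegrand_eq (h : N ≤ n) (g : Matrix (Fin n) (Fin N) 𝔽 → ℝ)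
    (B : Matrix (Fin n) (Fin N) 𝔽) (T : Matrix (Fin N) (Fin N) 𝔽) :
    petkantschinIntegrand 𝔽 g B T = modulus T ^ (n - N) * g (B * T) := by
  have h1 : ((beta 𝔽 : ℝ) * ((n : ℝ) - N) / 2) = (beta 𝔽 : ℝ) / 2 * ((n - N : ℕ) : ℝ) := by
    rw [Nat.cast_sub h]
    ring
  rw [petkantschinIntegrand, h1, Real.rpow_mul (MilesScalar.hdet_nonneg T),
    MilesScalar.hdet_rpow, Real.rpow_natCast, mul_comm]

omit hA in
theorem integrable_petkantschinIntegrand_iff (h : N ≤ n) {g : Matrix (Fin n) (Fin N) 𝔽 → ℝ}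
    (B : Matrix (Fin n) (Fin N) 𝔽) (hg : AEStronglyMeasurable g (frameMeasure B)) :
    Integrable (petkantschinIntegrand 𝔽 g B) ↔ Integrable g (frameMeasure B) := by
  rw [frameMeasure, integrable_map_measure hg (measurable_const_matrix_mul B).aemeasurable,
    weightedVolume, integrable_withDensity_iff_integrable_smul' measurable_weight
      (ae_of_all _ fun _ => ENNReal.ofReal_lt_top)]
  refine integrable_congr (ae_of_all _ fun T => ?_)
  simp only [petkantschinIntegrand_eq h, ENNReal.toReal_ofReal (pow_nonneg (modulus_nonneg T) _),
    smul_eq_mul, Function.comp_apply]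

omit hA in
theorem integral_petkantschinIntegrand (h : N ≤ n) {g : Matrix (Fin n) (Fin N) 𝔽 → ℝ}
    (B : Matrix (Fin n) (Fin N) 𝔽) (hg : AEStronglyMeasurable g (frameMeasure B)) :
    ∫ T, petkantschinIntegrand 𝔽 g B T = ∫ M, g M ∂frameMeasure B := by
  rw [frameMeasure, integral_map (measurable_const_matrix_mul B).aemeasurable hg,
    weightedVolume, integral_withDensity_eq_integral_toReal_smul measurable_weight
      (ae_of_all _ fun _ => ENNReal.ofReal_lt_top)]
  refine integral_congr_ae (ae_of_all _ fun T => ?_)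
  simp only [petkantschinIntegrand_eq h, ENNReal.toReal_ofReal (pow_nonneg (modulus_nonneg T) _),
    smul_eq_mul]

omit hA in
theorem blaschkePetkantschinMiles_of_milesScalar (h : N ≤ n) : BlaschkePetkantschinMiles 𝔽 h := by
  intro g hg A hA
  obtain ⟨h1, h2, h3⟩ := integral_eq_integral_frameMeasure hA h hg
  have hval : (fun V => ∫ T, petkantschinIntegrand 𝔽 g (A V) T) =ᵐ[grassmannMeasure 𝔽 h]
      fun V => ∫ M, g M ∂frameMeasure (A V) := by
    filter_upwards [h1] with V hV
    exact integral_petkantschinIntegrand h (A V) hV.1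
  refine ⟨?_, h2.congr hval.symm, ?_⟩
  · filter_upwards [h1] with V hV
    exact (integrable_petkantschinIntegrand_iff h (A V) hV.1).2 hV
  · rw [h3, integral_congr_ae hval]

end Descent

end

theorem mainTheorem2 (n N : ℕ) (h : N ≤ n) :
    BlaschkePetkantschinMiles ℝ h ∧ BlaschkePetkantschinMiles ℂ h ∧
      BlaschkePetkantschinMiles ℍ[ℝ] h :=
  ⟨blaschkePetkantschinMiles_of_milesScalar h, blaschkePetkantschinMiles_of_milesScalar h,
    blaschkePetkantschinMiles_of_milesScalar h⟩
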